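/- Let $X_1,X_2,\ldots$ be i.i.d. real random variables with distribution function $F_1$ and density $f_1$, and let $Y_1,Y_2,\ldots$ be i.i.d. with distribution function $F_2$ and density $f_2$, the two sequences being independent of each other. For a distribution function $F$ and $p\in(0,1)$ let $\mathcal Q_p(F)=\inf\{x: F(x)\ge p\}$, and put $x_p=\mathcal Q_p(F_1)$, $y_p=\mathcal Q_p(F_2)$, $g_1(p)=1/f_1(x_p)$, $g_2(p)=1/f_2(y_p)$. Define the functionals $$\mathsf r_p(F,G)=\frac{\mathcal Q_p(F)}{\mathcal Q_p(G)},\qquad \mathcal R_p(F,G)=\left[\frac{\mathcal Q_{1-p}(F)-\mathcal Q_p(F)}{\mathcal Q_{1-p}(G)-\mathcal Q_p(G)}\right]^2,$$ with $r_p=\mathsf r_p(F_1,F_2)$ and $R_p=\mathcal R_p(F_1,F_2)$. Let $F_{n_1}$ and $F_{n_2}$ be the empirical distribution functions of $X_1,\ldots,X_{n_1}$ and $Y_1,\ldots,Y_{n_2}$, and let $w_i=n_i/(n_1+n_2)$ for $n_1,n_2\ge1$. For a functional $T$ of two distribution functions and $x_0\in\mathbb R$, the partial influence functions are $$\mathrm{PIF}_1(x_0;T)=\lim_{\epsilon\downarrow0}\frac{T[(1-\epsilon)F_1+\epsilon\Delta_{x_0},F_2]-T(F_1,F_2)}{\epsilon},\qquad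 \mathrm{PIF}_2(x_0;T)=\lim_{\epsilon\downarrow0}\frac{T[F_1,(1-\epsilon)F_2+\epsilon\Delta_{x_0}]-T(F_1,F_2)}{\epsilon},$$ where $\Delta_{x_0}$ is the distribution function of the unit mass at $x_0$. We say that $T$ has asymptotic variance $\mathrm{ASV}(T;n_1,n_2)$ if (i) $\mathrm{PIF}_i(x_0;T)$ exists for $F_i$-almost every $x_0$ and is square integrable with respect to $F_i$ $(i=1,2)$, and for all $n_1,n_2\ge 1$ $$\mathrm{ASV}(T;n_1,n_2)=\frac1{w_1}E_{F_1}\!\left[\mathrm{PIF}_1(X;T)^2\right]+\frac1{w_2}E_{F_2}\!\left[\mathrm{PIF}_2(Y;T)^2\right];$$ (ii) $\sqrt{n_1+n_2}\,[T(F_{n_1},F_{n_2})-T(F_1,F_2)]$ is asymptotically normal with mean zero and variance $\mathrm{ASV}(T;n_1,n_2)$; that is, as $n_1\to\infty$ and $n_2\to\infty$, $$\frac{\sqrt{n_1+n_2}\,[T(F_{n_1},F_{n_2})-T(F_1,F_2)]}{\sqrt{\mathrm{ASV}(T;n_1,n_2)}}\ \xrightarrow{\ d\ }\ N(0,1).$$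 **Theorem.** (a) Let $p\in(0,1)$, let $x_p\ne0$ and $y_p\neq0$, and let $f_1$ be continuous and positive at $x_p$ and $f_2$ continuous and positive at $y_p$. Then $\mathsf r_p$ has asymptotic variance $$\mathrm{ASV}(\mathsf r_p;n_1,n_2)=p(1-p)\,r_p^2\left\{\frac{g_1(p)^2}{w_1x_p^2}+\frac{g_2(p)^2}{w_2y_p^2}\right\}.$$ (b) Let $p\in(0,1/2)$, let $f_1$ be continuous and positive at $x_p$ and $x_{1-p}$, and let $f_2$ be continuous and positive at $y_p$ and $y_{1-p}$. Then $\mathcal R_p$ has asymptotic variance $$\mathrm{ASV}(\mathcal R_p;n_1,n_2)=4p\,R_p^2\left\{\frac{g_1(p)^2+g_1(1-p)^2-p\,[g_1(p)+g_1(1-p)]^2}{w_1(x_{1-p}-x_p)^2}+\frac{g_2(p)^2+g_2(1-p)^2-p\,[g_2(p)+g_2(1-p)]^2}{w_2(y_{1-p}-y_p)^2}\right\}.$$ -/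

import Mathlib

open MeasureTheory ProbabilityTheory Filter Topology

noncomputable section

namespace QuantileRatio

/-- The `p`-th quantile `inf {x : F x ≥ p}` of a distribution function `F`. -/
def quantile (F : ℝ → ℝ) (p : ℝ) : ℝ := sInf {x : ℝ | p ≤ F x}

/-- The quantile density `g(p) = 1 / f(F⁻¹(p))` of a distribution function `F` with density `f`. -/
def quantileDensity (F f : ℝ → ℝ) (p : ℝ) : ℝ := 1 / f (quantile F p)

/-- The interquantile range `F⁻¹(1 - p) - F⁻¹(p)`. -/
def iqr (F : ℝ → ℝ) (p : ℝ) : ℝ := quantile F (1 - p) - quantile F p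

/-- The functional "ratio of `p`-th quantiles". -/
def quantileRatio (p : ℝ) (F₁ F₂ : ℝ → ℝ) : ℝ := quantile F₁ p / quantile F₂ p

/-- The functional "squared ratio of interquantile ranges". -/
def sqIqrRatio (p : ℝ) (F₁ F₂ : ℝ → ℝ) : ℝ := (iqr F₁ p / iqr F₂ p) ^ 2

/-- The distribution function of the unit mass at `x₀`. -/
def pointMassCDF (x₀ t : ℝ) : ℝ := if x₀ ≤ t then 1 else 0

/-- The empirical distribution function of the sample `x 0, …, x (n - 1)`. -/
def empiricalCDF (x : ℕ → ℝ) (n : ℕ) (t : ℝ) : ℝ :=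
  (∑ i ∈ Finset.range n, pointMassCDF (x i) t) / n

/-- The contaminated distribution function `(1 - ε) F + ε Δ_{x₀}`. -/
def contaminated (F : ℝ → ℝ) (x₀ ε t : ℝ) : ℝ := (1 - ε) * F t + ε * pointMassCDF x₀ t

/-- The first partial influence function of `T` at `(F₁, F₂)` exists at the contaminant `x₀`
and has the value `v` (the contamination `ε ∈ [0, 1]` tends to `0`). -/
def HasPIF₁ (T : (ℝ → ℝ) → (ℝ → ℝ) → ℝ) (F₁ F₂ : ℝ → ℝ) (x₀ v : ℝ) : Prop :=
  Tendsto (fun ε : ℝ => (T (contaminated F₁ x₀ ε) F₂ - T F₁ F₂) / ε) (𝓝[>] 0) (𝓝 v)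

/-- The second partial influence function of `T` at `(F₁, F₂)` exists at the contaminant `x₀`
and has the value `v`. -/
def HasPIF₂ (T : (ℝ → ℝ) → (ℝ → ℝ) → ℝ) (F₁ F₂ : ℝ → ℝ) (x₀ v : ℝ) : Prop :=
  Tendsto (fun ε : ℝ => (T F₁ (contaminated F₂ x₀ ε) - T F₁ F₂) / ε) (𝓝[>] 0) (𝓝 v)

/-- `V = w₁⁻¹ E[PIF₁(X)²] + w₂⁻¹ E[PIF₂(Y)²]` for `X ∼ μ₁`, `Y ∼ μ₂`: the partial influence
functions of `T` at the distribution functions of `μ₁`, `μ₂` exist almost everywhere, are square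
integrable, and give the value `V`. -/
def IsInfluenceASV (T : (ℝ → ℝ) → (ℝ → ℝ) → ℝ) (μ₁ μ₂ : Measure ℝ) (w₁ w₂ V : ℝ) : Prop :=
  ∃ φ₁ φ₂ : ℝ → ℝ,
    (∀ᵐ x ∂μ₁, HasPIF₁ T (cdf μ₁) (cdf μ₂) x (φ₁ x)) ∧
    (∀ᵐ y ∂μ₂, HasPIF₂ T (cdf μ₁) (cdf μ₂) y (φ₂ y)) ∧
    MemLp φ₁ 2 μ₁ ∧ MemLp φ₂ 2 μ₂ ∧
    V = (1 / w₁) * ∫ x, φ₁ x ^ 2 ∂μ₁ + (1 / w₂) * ∫ y, φ₂ y ^ 2 ∂μ₂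

/-- `√(n₁ + n₂) (T(F_{n₁}, F_{n₂}) - θ)` is asymptotically normal with mean `0` and variance
`V n₁ n₂` as `n₁, n₂ → ∞` (independently of each other): divided by `√(V n₁ n₂)` it converges in
distribution to the standard normal law. -/
def AsymptoticallyNormal {Ω : Type*} [MeasurableSpace Ω] (P : Measure Ω) [IsProbabilityMeasure P]
    (X Y : ℕ → Ω → ℝ) (T : (ℝ → ℝ) → (ℝ → ℝ) → ℝ) (θ : ℝ) (V : ℕ → ℕ → ℝ) : Prop :=
  TendstoInDistribution
    (fun (n : ℕ × ℕ) (ω : Ω) =>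
      √((n.1 : ℝ) + (n.2 : ℝ)) *
        (T (empiricalCDF (fun i => X i ω) n.1) (empiricalCDF (fun i => Y i ω) n.2) - θ) /
          √(V n.1 n.2))
    (atTop ×ˢ atTop) (id : ℝ → ℝ) (fun _ => P) (gaussianReal 0 1)

/-- The sample fraction `m / (m + n)`. -/
def weight (m n : ℕ) : ℝ := (m : ℝ) / ((m : ℝ) + (n : ℝ))

/-- The variance formula for the ratio of `p`-th quantiles. -/
def asvQuantileRatio (F₁ F₂ f₁ f₂ : ℝ → ℝ) (p : ℝ) (n₁ n₂ : ℕ) : ℝ :=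
  p * (1 - p) * quantileRatio p F₁ F₂ ^ 2 *
    (quantileDensity F₁ f₁ p ^ 2 / (weight n₁ n₂ * quantile F₁ p ^ 2) +
      quantileDensity F₂ f₂ p ^ 2 / (weight n₂ n₁ * quantile F₂ p ^ 2))

/-- The variance formula for the squared ratio of interquantile ranges. -/
def asvSqIqrRatio (F₁ F₂ f₁ f₂ : ℝ → ℝ) (p : ℝ) (n₁ n₂ : ℕ) : ℝ :=
  4 * p * sqIqrRatio p F₁ F₂ ^ 2 *
    ((quantileDensity F₁ f₁ p ^ 2 + quantileDensity F₁ f₁ (1 - p) ^ 2 -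
          p * (quantileDensity F₁ f₁ p + quantileDensity F₁ f₁ (1 - p)) ^ 2) /
        (weight n₁ n₂ * iqr F₁ p ^ 2) +
      (quantileDensity F₂ f₂ p ^ 2 + quantileDensity F₂ f₂ (1 - p) ^ 2 -
          p * (quantileDensity F₂ f₂ p + quantileDensity F₂ f₂ (1 - p)) ^ 2) /
        (weight n₂ n₁ * iqr F₂ p ^ 2))

/-- `f` is continuous and positive at the `p`-th quantile of `F`. -/
def RegularAtQuantile (F f : ℝ → ℝ) (p : ℝ) : Prop :=
  ContinuousAt f (quantile F p) ∧ 0 < f (quantile F p)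

end QuantileRatio

end

open QuantileRatio

/-!
Both functionals have the form `T F G = h (S F, S G)`, where `S` is a quantile or an interquantile
range and `h` is `x / y` or `(x / y) ^ 2`. The theorem is a delta method over a linear expansion of
`S`, recorded in `HasInfluenceExpansion`: the plug-in estimator satisfies
`√n (S F_n - S F) = n^{-1/2} ∑ φ(X_i) + o_P(1)`, with `φ` the influence function of `S`.

For quantiles, everything rests on the fact that `G a < p ≤ G b` places the `p`-th quantile of a
monotone `G` in `[a, b]`. Evaluating the contaminated distribution function at `x_p + ε v` gives the
influence function `φ(x) = (p - 1{x ≤ x_p}) / f(x_p)` (`hasInfluence_quantile`). For the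
empirical distribution function, Chebyshev's inequality shows that
`√n (F_n(x_p + t/√n) - F_n(x_p)) → f(x_p) t` in probability for each `t`; using this at the points
of a fine finite grid, the sample quantile is trapped next to its linear approximation
(`isAsymptoticallyLinear_quantile`, the Bahadur representation). Only differentiability of the
distribution function at `x_p` with positive derivative is used.

The sample sizes tend to infinity independently, so the weights of the two samples in the
normalized statistic need not converge. The two-sample central limit theorem
`tendstoInDistribution_add_normalizedSum` therefore allows arbitrary weights of total variance
`1`: the characteristic functions of normalized sums converge to the Gaussian one uniformly on
bounded sets (`tendsto_charFun_pow_sub_gaussian`). The linearization error of `h` is negligible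
because the asymptotic standard deviation `√(v₁/n₁ + v₂/n₂)` dominates both `n₁^{-1/2}` and
`n₂^{-1/2}` up to constants (`tendsto_measureReal_delta_remainder`).
-/

namespace QuantileRatio


/-! ### Quantiles of monotone functions -/

lemma le_quantile {G : ℝ → ℝ} (hG : Monotone G) {p a b : ℝ} (ha : G a < p) (hb : p ≤ G b) :
    a ≤ quantile G p :=
  le_csInf ⟨b, hb⟩ fun _ hx => le_of_not_ge fun hxa => absurd (hG hxa) (not_le.2 (ha.trans_le hx))

lemma quantile_le {G : ℝ → ℝ} (hG : Monotone G) {p a b : ℝ} (ha : G a < p) (hb : p ≤ G b) :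
    quantile G p ≤ b :=
  csInf_le ⟨a, fun _ hx => le_of_not_ge fun hxa =>
    absurd (hG hxa) (not_le.2 (ha.trans_le hx))⟩ hb

lemma quantile_lt_iff {G : ℝ → ℝ} (hG : Monotone G) {p a b : ℝ} (ha : G a < p) (hb : p ≤ G b)
    (t : ℝ) : quantile G p < t ↔ ∃ r : ℚ, (r : ℝ) < t ∧ p ≤ G r := by
  constructor
  · intro h
    obtain ⟨x, hx, hxt⟩ := exists_lt_of_csInf_lt (s := {x : ℝ | p ≤ G x}) ⟨b, hb⟩ h
    obtain ⟨r, hxr, hrt⟩ := exists_rat_btwn hxt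
    exact ⟨r, hrt, le_trans hx (hG hxr.le)⟩
  · rintro ⟨r, hrt, hr⟩
    exact (quantile_le hG ha hr).trans_lt hrt

lemma monotone_pointMassCDF (x₀ : ℝ) : Monotone (pointMassCDF x₀) := by
  intro s t hst
  unfold pointMassCDF
  split_ifs with h1 h2
  · exact le_rfl
  · exact absurd (h1.trans hst) h2
  · exact zero_le_one
  · exact le_rfl

lemma pointMassCDF_nonneg (x₀ t : ℝ) : 0 ≤ pointMassCDF x₀ t := by
  unfold pointMassCDF; split_ifs <;> norm_num

lemma pointMassCDF_le_one (x₀ t : ℝ) : pointMassCDF x₀ t ≤ 1 := by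
  unfold pointMassCDF; split_ifs <;> norm_num

lemma measurable_pointMassCDF (t : ℝ) : Measurable fun x => pointMassCDF x t :=
  Measurable.ite measurableSet_Iic measurable_const measurable_const

lemma monotone_contaminated {F : ℝ → ℝ} (hF : Monotone F) (x₀ : ℝ) {ε : ℝ} (h0 : 0 ≤ ε)
    (h1 : ε ≤ 1) : Monotone (contaminated F x₀ ε) := fun s t hst =>
  add_le_add (mul_le_mul_of_nonneg_left (hF hst) (by linarith))
    (mul_le_mul_of_nonneg_left (monotone_pointMassCDF x₀ hst) h0)

lemma contaminated_zero (F : ℝ → ℝ) (x₀ : ℝ) : contaminated F x₀ 0 = F := by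
  ext t; simp [contaminated]

lemma monotone_empiricalCDF (x : ℕ → ℝ) (n : ℕ) : Monotone (empiricalCDF x n) := fun _ _ hst =>
  div_le_div_of_nonneg_right
    (Finset.sum_le_sum fun i _ => monotone_pointMassCDF (x i) hst) (Nat.cast_nonneg n)

/-- The empirical distribution function of a non-empty sample attains both `0` and `1`. -/
lemma exists_empiricalCDF_eq (x : ℕ → ℝ) {n : ℕ} (hn : 0 < n) :
    ∃ a b, empiricalCDF x n a = 0 ∧ empiricalCDF x n b = 1 := by
  have key : ∀ i ∈ Finset.range n, |x i| ≤ ∑ j ∈ Finset.range n, |x j| := fun i hi =>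
    Finset.single_le_sum (f := fun j => |x j|) (fun j _ => abs_nonneg _) hi
  refine ⟨-(∑ j ∈ Finset.range n, |x j|) - 1, ∑ j ∈ Finset.range n, |x j|, ?_, ?_⟩
  · unfold empiricalCDF
    rw [Finset.sum_eq_zero, zero_div]
    intro i hi
    have := key i hi
    have := neg_abs_le (x i)
    exact if_neg (by linarith)
  · unfold empiricalCDF
    rw [Finset.sum_congr rfl (g := fun _ => (1 : ℝ))]
    · simp [hn.ne']
    · intro i hi
      exact if_pos ((le_abs_self _).trans (key i hi))

lemma measurable_quantile_empiricalCDF {p : ℝ} (hp0 : 0 < p) (hp1 : p < 1) (n : ℕ) :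
    Measurable fun x : ℕ → ℝ => quantile (empiricalCDF x n) p := by
  rcases Nat.eq_zero_or_pos n with rfl | hn
  -- For `n = 0` the empirical distribution function is the constant `0`, by `x / 0 = 0`.
  · have : (fun x : ℕ → ℝ => quantile (empiricalCDF x 0) p)
        = fun _ => quantile (fun _ => 0) p := by
      ext x; congr 1; ext t; simp [empiricalCDF]
    rw [this]; exact measurable_const
  · refine measurable_of_Iio fun t => ?_
    have : (fun x : ℕ → ℝ => quantile (empiricalCDF x n) p) ⁻¹' Set.Iio t
        = ⋃ r : ℚ, {x | (r : ℝ) < t ∧ p ≤ empiricalCDF x n r} := by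
      ext x
      obtain ⟨a, b, ha, hb⟩ := exists_empiricalCDF_eq x hn
      simp only [Set.mem_preimage, Set.mem_Iio, Set.mem_iUnion, Set.mem_ofPred_eq]
      exact quantile_lt_iff (monotone_empiricalCDF x n) (ha ▸ hp0) (hb ▸ hp1.le) t
    rw [this]
    have hmeas : ∀ r : ℚ, MeasurableSet {x : ℕ → ℝ | p ≤ empiricalCDF x n r} := fun r =>
      measurableSet_le measurable_const ?_
    · exact MeasurableSet.iUnion fun r => (MeasurableSet.const _).inter (hmeas r)
    exact (Finset.measurable_sum _ fun i _ =>
      (measurable_pointMassCDF r).comp (measurable_pi_apply i)).div_const _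

/-! ### Distribution functions with a density -/

lemma integrable_density {μ : Measure ℝ} [IsProbabilityMeasure μ] {f : ℝ → ℝ}
    (hf : Measurable f) (hf0 : ∀ x, 0 ≤ f x)
    (hμ : μ = volume.withDensity fun x => ENNReal.ofReal (f x)) : Integrable f := by
  refine ⟨hf.aestronglyMeasurable, ?_⟩
  rw [hasFiniteIntegral_iff_ofReal (ae_of_all _ hf0)]
  have : ∫⁻ x, ENNReal.ofReal (f x) = μ Set.univ := by
    rw [hμ, withDensity_apply _ MeasurableSet.univ, setLIntegral_univ]
  rw [this]; exact measure_lt_top _ _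

lemma cdf_eq_setIntegral {μ : Measure ℝ} [IsProbabilityMeasure μ] {f : ℝ → ℝ}
    (hf : Measurable f) (hf0 : ∀ x, 0 ≤ f x)
    (hμ : μ = volume.withDensity fun x => ENNReal.ofReal (f x)) (x : ℝ) :
    cdf μ x = ∫ t in Set.Iic x, f t := by
  have h := integrable_density hf hf0 hμ
  rw [cdf_eq_real, measureReal_def]
  conv_lhs => rw [hμ]
  rw [withDensity_apply _ measurableSet_Iic,
    integral_eq_lintegral_of_nonneg_ae (ae_of_all _ hf0) hf.aestronglyMeasurable]

lemma hasDerivAt_cdf {μ : Measure ℝ} [IsProbabilityMeasure μ] {f : ℝ → ℝ}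
    (hf : Measurable f) (hf0 : ∀ x, 0 ≤ f x)
    (hμ : μ = volume.withDensity fun x => ENNReal.ofReal (f x)) {x : ℝ} (hc : ContinuousAt f x) :
    HasDerivAt (cdf μ) (f x) x := by
  have h := integrable_density hf hf0 hμ
  have hd : HasDerivAt (fun u => ∫ t in x..u, f t) (f x) x :=
    intervalIntegral.integral_hasDerivAt_right h.intervalIntegrable
      hf.stronglyMeasurable.stronglyMeasurableAtFilter hc
  refine (hd.add_const (cdf μ x)).congr_of_eventuallyEq (Eventually.of_forall fun u => ?_)
  simp only
  rw [cdf_eq_setIntegral hf hf0 hμ, cdf_eq_setIntegral hf hf0 hμ,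
    ← intervalIntegral.integral_Iic_sub_Iic h.integrableOn h.integrableOn]
  ring

lemma ae_ne_of_density {μ : Measure ℝ} {f : ℝ → ℝ}
    (hμ : μ = volume.withDensity fun x => ENNReal.ofReal (f x)) (q : ℝ) :
    ∀ᵐ x ∂μ, x ≠ q := by
  rw [hμ]
  exact (withDensity_absolutelyContinuous _ _).ae_le (Measure.ae_ne volume q)

lemma exists_cdf_lt_and_le (μ : Measure ℝ) {p : ℝ} (hp0 : 0 < p) (hp1 : p < 1) :
    ∃ a b, cdf μ a < p ∧ p ≤ cdf μ b :=
  let ⟨a, ha⟩ := ((tendsto_cdf_atBot μ).eventually_lt_const hp0).exists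
  let ⟨b, hb⟩ := ((tendsto_cdf_atTop μ).eventually_const_lt hp1).exists
  ⟨a, b, ha, hb.le⟩

/-- The infimum is attained by continuity from the right, while continuity from the left
gives `F (F⁻¹ p) ≤ p`. -/
lemma cdf_quantile {μ : Measure ℝ} {p : ℝ} (hp0 : 0 < p) (hp1 : p < 1)
    (hc : ContinuousAt (cdf μ) (quantile (cdf μ) p)) : cdf μ (quantile (cdf μ) p) = p := by
  obtain ⟨a, b, ha, hb⟩ := exists_cdf_lt_and_le μ hp0 hp1
  set q := quantile (cdf μ) p
  refine le_antisymm ?_ ?_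
  · refine le_of_tendsto (hc.mono_left nhdsWithin_le_nhds : Tendsto _ (𝓝[<] q) _) ?_
    filter_upwards [self_mem_nhdsWithin] with x hx
    refine le_of_lt (not_le.1 fun hpx => ?_)
    exact absurd (quantile_le (monotone_cdf μ) ha hpx) (not_le.2 hx)
  · refine ge_of_tendsto (hc.mono_left nhdsWithin_le_nhds : Tendsto _ (𝓝[>] q) _) ?_
    filter_upwards [self_mem_nhdsWithin] with x hx
    obtain ⟨r, hr, hpr⟩ := (quantile_lt_iff (monotone_cdf μ) ha hb x).1 hx
    exact hpr.trans (monotone_cdf μ hr.le)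

/-! ### Influence functions -/

/-- The one-sample influence function of `S` at `F` exists at the contaminant `x₀` and has the
value `v`. -/
def HasInfluence (S : (ℝ → ℝ) → ℝ) (F : ℝ → ℝ) (x₀ v : ℝ) : Prop :=
  Tendsto (fun ε : ℝ => (S (contaminated F x₀ ε) - S F) / ε) (𝓝[>] 0) (𝓝 v)

lemma hasInfluence_iff_hasDerivWithinAt {S : (ℝ → ℝ) → ℝ} {F : ℝ → ℝ} {x₀ v : ℝ} :
    HasInfluence S F x₀ v ↔
      HasDerivWithinAt (fun ε => S (contaminated F x₀ ε)) v (Set.Ioi 0) 0 := by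
  rw [hasDerivWithinAt_iff_tendsto_slope' (Set.notMem_Ioi.2 le_rfl), HasInfluence]
  refine tendsto_congr fun ε => ?_
  simp [slope_def_field, contaminated_zero]

/-- The influence function `x ↦ (p - 1{x ≤ q}) g` of the `p`-th quantile `q`, where `g` is the
quantile density at `p`. -/
noncomputable def quantileInfluence (p q g x : ℝ) : ℝ := (p - pointMassCDF x q) * g

/-- Contaminants at the quantile itself are excluded: there the indicator `1{x₀ ≤ q + ε v}` does
not stabilize for `v` of both signs. -/
lemma hasInfluence_quantile {F : ℝ → ℝ} (hF : Monotone F) {p d : ℝ} (hd : 0 < d)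
    (hder : HasDerivAt F d (quantile F p)) (hq : F (quantile F p) = p) {x₀ : ℝ}
    (hx₀ : x₀ ≠ quantile F p) :
    HasInfluence (fun G => quantile G p) F x₀ (quantileInfluence p (quantile F p) (1 / d) x₀) := by
  set q := quantile F p
  set δ := pointMassCDF x₀ q with hδ
  set c := quantileInfluence p q (1 / d) x₀ with hc
  have hdc : d * c = p - δ := by
    rw [hc, hδ, quantileInfluence]; field_simp
  -- Along `q + ε v`, the contaminated distribution function is `p + ε d (v - c) + o(ε)`.
  have expand : ∀ v : ℝ, Tendsto
      (fun ε : ℝ => (contaminated F x₀ ε (q + ε * v) - p) / ε) (𝓝[>] 0) (𝓝 (d * (v - c))) := by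
    intro v
    have hlin : HasDerivAt (fun ε : ℝ => q + ε * v) v 0 := by
      simpa using ((hasDerivAt_id (0 : ℝ)).mul_const v).const_add q
    have hcomp : HasDerivAt (fun ε : ℝ => F (q + ε * v)) (d * v) 0 :=
      HasDerivAt.comp (h₂ := F) (0 : ℝ) (by simpa using hder) hlin
    have h1 : Tendsto (fun ε : ℝ => (F (q + ε * v) - p) / ε) (𝓝[>] 0) (𝓝 (d * v)) := by
      have := (hcomp.hasDerivWithinAt (s := Set.Ioi 0))
      rw [hasDerivWithinAt_iff_tendsto_slope' (Set.notMem_Ioi.2 le_rfl)] at this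
      refine this.congr fun ε => ?_
      simp [slope_def_field, hq]
    have hcont : Tendsto (fun ε : ℝ => q + ε * v) (𝓝[>] 0) (𝓝 q) := by
      have := hlin.continuousAt.tendsto
      simp only [zero_mul, add_zero] at this
      exact this.mono_left nhdsWithin_le_nhds
    have h2 : Tendsto (fun ε : ℝ => F (q + ε * v)) (𝓝[>] 0) (𝓝 p) := by
      have := hcomp.continuousAt.tendsto
      simp only [zero_mul, add_zero, hq] at this
      exact this.mono_left nhdsWithin_le_nhds
    have h3 : ∀ᶠ ε in 𝓝[>] (0 : ℝ), pointMassCDF x₀ (q + ε * v) = δ := by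
      rcases lt_or_gt_of_ne hx₀ with h | h
      · filter_upwards [hcont.eventually_const_lt h] with ε hε
        simp [hδ, pointMassCDF, h.le, hε.le]
      · filter_upwards [hcont.eventually_lt_const h] with ε hε
        simp [hδ, pointMassCDF, not_le.2 h, not_le.2 hε]
    have h4 := (h1.sub h2).add_const δ
    rw [show d * v - p + δ = d * (v - c) by rw [mul_sub, hdc]; ring] at h4
    refine h4.congr' ?_
    filter_upwards [h3, self_mem_nhdsWithin] with ε hε hε0
    have : ε ≠ 0 := ne_of_gt hε0
    rw [contaminated, hε]
    field_simp
    ring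
  rw [HasInfluence, Metric.tendsto_nhds]
  intro η hη
  have hlow := (expand (c - η / 2)).eventually_lt_const
    (show d * (c - η / 2 - c) < 0 by nlinarith)
  have hup := (expand (c + η / 2)).eventually_const_lt
    (show 0 < d * (c + η / 2 - c) by nlinarith)
  have hlt : ∀ᶠ ε in 𝓝[>] (0 : ℝ), ε < 1 :=
    (tendsto_id.mono_left nhdsWithin_le_nhds : Tendsto id (𝓝[>] (0 : ℝ)) (𝓝 0)).eventually_lt_const
      one_pos
  filter_upwards [hlow, hup, hlt, self_mem_nhdsWithin] with ε h1 h2 h3 h4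
  have hε : 0 < ε := h4
  have hmono := monotone_contaminated hF x₀ hε.le h3.le
  have ha : contaminated F x₀ ε (q + ε * (c - η / 2)) < p := by
    rw [div_lt_iff₀ hε] at h1; linarith
  have hb : p ≤ contaminated F x₀ ε (q + ε * (c + η / 2)) := by
    rw [lt_div_iff₀ hε] at h2; linarith
  have l1 := le_quantile hmono ha hb
  have l2 := quantile_le hmono ha hb
  rw [Real.dist_eq, abs_lt, lt_sub_iff_add_lt, sub_lt_iff_lt_add, lt_div_iff₀ hε, div_lt_iff₀ hε]
  constructor <;> nlinarith

lemma measurable_quantileInfluence (p q g : ℝ) : Measurable (quantileInfluence p q g) :=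
  (measurable_const.sub (measurable_pointMassCDF q)).mul_const g

lemma abs_quantileInfluence_le {p : ℝ} (hp0 : 0 < p) (hp1 : p < 1) (q g x : ℝ) :
    |quantileInfluence p q g x| ≤ |g| := by
  rw [quantileInfluence, abs_mul]
  refine mul_le_of_le_one_left (abs_nonneg _) (abs_le.2 ?_)
  have := pointMassCDF_nonneg x q
  have := pointMassCDF_le_one x q
  constructor <;> linarith

lemma memLp_quantileInfluence {μ : Measure ℝ} [IsProbabilityMeasure μ] {p : ℝ} (hp0 : 0 < p)
    (hp1 : p < 1) (q g : ℝ) : MemLp (quantileInfluence p q g) 2 μ :=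
  MemLp.of_bound (measurable_quantileInfluence p q g).aestronglyMeasurable |g|
    (ae_of_all _ fun x => abs_quantileInfluence_le hp0 hp1 q g x)

lemma integrable_pointMassCDF (μ : Measure ℝ) [IsProbabilityMeasure μ] (q : ℝ) :
    Integrable (fun x => pointMassCDF x q) μ :=
  Integrable.of_bound (measurable_pointMassCDF q).aestronglyMeasurable 1 (ae_of_all _ fun x => by
    rw [Real.norm_eq_abs, abs_of_nonneg (pointMassCDF_nonneg x q)]; exact pointMassCDF_le_one x q)

lemma integral_pointMassCDF (μ : Measure ℝ) [IsProbabilityMeasure μ] (q : ℝ) :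
    ∫ x, pointMassCDF x q ∂μ = cdf μ q := by
  have : (fun x => pointMassCDF x q) = (Set.Iic q).indicator 1 := by
    ext x; simp [pointMassCDF, Set.indicator_apply]
  rw [this, integral_indicator_one measurableSet_Iic, cdf_eq_real]

lemma integral_quantileInfluence {μ : Measure ℝ} [IsProbabilityMeasure μ] {p q : ℝ}
    (hq : cdf μ q = p) (g : ℝ) : ∫ x, quantileInfluence p q g x ∂μ = 0 := by
  unfold quantileInfluence
  rw [integral_mul_const, integral_sub (integrable_const _) (integrable_pointMassCDF μ q),
    integral_pointMassCDF, hq]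
  simp

/-- The covariance of two quantile influence functions comes from
`cov(1{X ≤ q}, 1{X ≤ q'}) = p (1 - p')` for `q ≤ q'`. -/
lemma integral_quantileInfluence_mul {μ : Measure ℝ} [IsProbabilityMeasure μ] {p p' q q' : ℝ}
    (hq : cdf μ q = p) (hq' : cdf μ q' = p') (hle : q ≤ q') (g g' : ℝ) :
    ∫ x, quantileInfluence p q g x * quantileInfluence p' q' g' x ∂μ
      = p * (1 - p') * (g * g') := by
  have : ∀ x, quantileInfluence p q g x * quantileInfluence p' q' g' x
      = (p * p' + (1 - p') * pointMassCDF x q - p * pointMassCDF x q') * (g * g') := by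
    intro x
    have hI : pointMassCDF x q * pointMassCDF x q' = pointMassCDF x q := by
      unfold pointMassCDF
      by_cases h : x ≤ q
      · simp [h, h.trans hle]
      · simp [h]
    unfold quantileInfluence
    linear_combination (g * g') * hI
  simp_rw [this]
  have i1 := (integrable_pointMassCDF μ q).const_mul (1 - p')
  have i2 := (integrable_pointMassCDF μ q').const_mul p
  have i3 : Integrable (fun x => p * p' + (1 - p') * pointMassCDF x q) μ :=
    (integrable_const _).add i1
  rw [integral_mul_const, integral_sub i3 i2, integral_add (integrable_const _) i1,
    integral_const_mul (1 - p'), integral_const_mul p (fun x => pointMassCDF x q'),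
    integral_pointMassCDF, integral_pointMassCDF, hq, hq', integral_const, probReal_univ, one_smul]
  ring

lemma integral_quantileInfluence_sq {μ : Measure ℝ} [IsProbabilityMeasure μ] {p q : ℝ}
    (hq : cdf μ q = p) (g : ℝ) :
    ∫ x, quantileInfluence p q g x ^ 2 ∂μ = p * (1 - p) * g ^ 2 := by
  simp_rw [sq]
  exact integral_quantileInfluence_mul hq hq le_rfl g g

lemma integral_quantileInfluence_sub_sq {μ : Measure ℝ} [IsProbabilityMeasure μ] {p q q' : ℝ}
    (hp0 : 0 < p) (hp1 : p < 1) (hq : cdf μ q = p) (hq' : cdf μ q' = 1 - p) (hle : q ≤ q')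
    (g g' : ℝ) :
    ∫ x, (quantileInfluence (1 - p) q' g' x - quantileInfluence p q g x) ^ 2 ∂μ
      = p * (g ^ 2 + g' ^ 2 - p * (g + g') ^ 2) := by
  have m : MemLp (quantileInfluence p q g) 2 μ := memLp_quantileInfluence hp0 hp1 q g
  have m' : MemLp (quantileInfluence (1 - p) q' g') 2 μ :=
    memLp_quantileInfluence (by linarith) (by linarith) q' g'
  have : ∀ x, (quantileInfluence (1 - p) q' g' x - quantileInfluence p q g x) ^ 2
      = quantileInfluence (1 - p) q' g' x ^ 2 + quantileInfluence p q g x ^ 2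
        - 2 * (quantileInfluence p q g x * quantileInfluence (1 - p) q' g' x) := fun x => by ring
  simp_rw [this]
  have i1 : Integrable (fun x => quantileInfluence (1 - p) q' g' x ^ 2
      + quantileInfluence p q g x ^ 2) μ := m'.integrable_sq.add m.integrable_sq
  have i2 : Integrable (fun x => 2 * (quantileInfluence p q g x
      * quantileInfluence (1 - p) q' g' x)) μ := (m.integrable_mul m').const_mul 2
  rw [integral_sub i1 i2,
    integral_add m'.integrable_sq m.integrable_sq, integral_const_mul,
    integral_quantileInfluence_sq hq, integral_quantileInfluence_sq hq',
    integral_quantileInfluence_mul hq hq' hle]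
  ring


/-! ### Normalized sums -/

/-- The normalized sum `n^{-1/2} ∑_{i < n} φ(X i)`. -/
noncomputable def normalizedSum {Ω : Type*} (φ : ℝ → ℝ) (X : ℕ → Ω → ℝ) (n : ℕ) (ω : Ω) : ℝ :=
  (√(n : ℝ))⁻¹ * ∑ i ∈ Finset.range n, φ (X i ω)

lemma inv_sqrt_mul_self (n : ℕ) : (√(n : ℝ))⁻¹ * n = √(n : ℝ) := by
  rw [mul_comm, ← div_eq_mul_inv, Real.div_sqrt]

lemma sqrt_mul_div_self (n : ℕ) (x : ℝ) : √(n : ℝ) * (x / n) = (√(n : ℝ))⁻¹ * x := by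
  rw [← mul_div_assoc, mul_div_right_comm, Real.sqrt_div_self', one_div]

lemma normalizedSum_sub {Ω : Type*} (φ ψ : ℝ → ℝ) (X : ℕ → Ω → ℝ) (n : ℕ) (ω : Ω) :
    normalizedSum (fun x => φ x - ψ x) X n ω = normalizedSum φ X n ω - normalizedSum ψ X n ω := by
  simp [normalizedSum, Finset.sum_sub_distrib, mul_sub]

lemma aemeasurable_normalizedSum {Ω : Type*} [MeasurableSpace Ω] {P : Measure Ω}
    {μ : Measure ℝ} {X : ℕ → Ω → ℝ} (hX : ∀ i, HasLaw (X i) μ P) {φ : ℝ → ℝ} (hφ : Measurable φ)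
    (n : ℕ) : AEMeasurable (normalizedSum φ X n) P :=
  (Finset.aemeasurable_fun_sum _ fun i _ =>
    hφ.comp_aemeasurable (hX i).aemeasurable).const_mul _

/-- Chebyshev's inequality for the normalized sum of a centred function. -/
lemma measureReal_le_abs_normalizedSum {Ω : Type*} [MeasurableSpace Ω] {P : Measure Ω}
    [IsProbabilityMeasure P] {μ : Measure ℝ} {X : ℕ → Ω → ℝ}
    (hX : ∀ i, HasLaw (X i) μ P) (hind : iIndepFun X P)
    {φ : ℝ → ℝ} (hφ : Measurable φ) (h2 : MemLp φ 2 μ) (h0 : ∫ x, φ x ∂μ = 0) {c : ℝ}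
    (hc : 0 < c) (n : ℕ) :
    P.real {ω | c ≤ |normalizedSum φ X n ω|} ≤ (∫ x, φ x ^ 2 ∂μ) / c ^ 2 := by
  have hL : ∀ i, MemLp (fun ω => φ (X i ω)) 2 P := fun i =>
    MemLp.comp_of_map (by rwa [(hX i).map_eq]) (hX i).aemeasurable
  have hE : ∀ i, ∫ ω, φ (X i ω) ∂P = 0 := fun i =>
    ((hX i).integral_comp hφ.aestronglyMeasurable).trans h0
  have hV : ∀ i, Var[fun ω => φ (X i ω); P] = ∫ x, φ x ^ 2 ∂μ := fun i => by
    rw [variance_of_integral_eq_zero (hL i).aemeasurable (hE i)]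
    exact (hX i).integral_comp (f := fun x => φ x ^ 2) (hφ.pow_const 2).aestronglyMeasurable
  have hS : MemLp (fun ω => ∑ i ∈ Finset.range n, φ (X i ω)) 2 P :=
    memLp_finsetSum _ fun i _ => hL i
  have hZ : MemLp (normalizedSum φ X n) 2 P := hS.const_mul _
  have hEZ : ∫ ω, normalizedSum φ X n ω ∂P = 0 := by
    unfold normalizedSum
    rw [integral_const_mul, integral_finsetSum _ fun i _ => (hL i).integrable one_le_two]
    simp [hE]
  have hindep : Set.Pairwise (↑(Finset.range n) : Set ℕ)
      fun i j => IndepFun (fun ω => φ (X i ω)) (fun ω => φ (X j ω)) P := fun i _ j _ hij =>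
    (hind.indepFun hij).comp hφ hφ
  have hsum : (fun ω => ∑ i ∈ Finset.range n, φ (X i ω))
      = ∑ i ∈ Finset.range n, fun ω => φ (X i ω) := by
    ext ω; simp
  have hVZ : Var[normalizedSum φ X n; P] ≤ ∫ x, φ x ^ 2 ∂μ := by
    unfold normalizedSum
    rw [variance_const_mul, hsum, IndepFun.variance_sum (fun i _ => hL i) hindep]
    simp only [hV, Finset.sum_const, Finset.card_range, nsmul_eq_mul, inv_pow,
      Real.sq_sqrt (Nat.cast_nonneg n)]
    rw [← mul_assoc]
    exact mul_le_of_le_one_left (integral_nonneg fun x => sq_nonneg _)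
      (inv_mul_le_one_of_le₀ le_rfl (Nat.cast_nonneg n))
  have := meas_ge_le_variance_div_sq hZ hc
  simp only [hEZ, sub_zero] at this
  refine (ENNReal.toReal_le_of_le_ofReal (by have := variance_nonneg (normalizedSum φ X n) P
                                             positivity) this).trans ?_
  gcongr

/-! ### Asymptotic linearity -/

/-- The estimators `A n` of `a` are asymptotically linear with influence function `φ`:
`√n (A n - a) = n^{-1/2} ∑_{i < n} φ(X i) + o_P(1)`. -/
def IsAsymptoticallyLinear {Ω : Type*} [MeasurableSpace Ω] (P : Measure Ω) (X A : ℕ → Ω → ℝ)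
    (a : ℝ) (φ : ℝ → ℝ) : Prop :=
  TendstoInMeasure P (fun (n : ℕ) ω => √(n : ℝ) * (A n ω - a) - normalizedSum φ X n ω) atTop 0

section Sample

variable {Ω : Type*} [MeasurableSpace Ω] {P : Measure Ω} [IsProbabilityMeasure P]
  {X : ℕ → Ω → ℝ}

lemma isAsymptoticallyLinear_iff {A : ℕ → Ω → ℝ} {a : ℝ} {φ : ℝ → ℝ} :
    IsAsymptoticallyLinear P X A a φ ↔ ∀ ε, 0 < ε → Tendsto (fun n : ℕ =>
      P.real {ω | ε ≤ |√(n : ℝ) * (A n ω - a) - normalizedSum φ X n ω|}) atTop (𝓝 0) := by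
  simp [IsAsymptoticallyLinear, tendstoInMeasure_iff_measureReal_norm]

lemma IsAsymptoticallyLinear.sub {A B : ℕ → Ω → ℝ} {a b : ℝ} {φ ψ : ℝ → ℝ}
    (hA : IsAsymptoticallyLinear P X A a φ) (hB : IsAsymptoticallyLinear P X B b ψ) :
    IsAsymptoticallyLinear P X (fun n ω => A n ω - B n ω) (a - b) (fun x => φ x - ψ x) := by
  rw [isAsymptoticallyLinear_iff] at *
  intro ε hε
  have := (hA (ε / 2) (half_pos hε)).add (hB (ε / 2) (half_pos hε))
  rw [add_zero] at this
  refine squeeze_zero (fun n => measureReal_nonneg) (fun n => ?_) this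
  refine (measureReal_mono ?_).trans (measureReal_union_le _ _)
  intro ω hω
  by_contra hcon
  simp only [Set.mem_union, Set.mem_ofPred_eq, not_or, not_le] at hcon hω
  have h1 := abs_lt.1 hcon.1
  have h2 := abs_lt.1 hcon.2
  rw [normalizedSum_sub] at hω
  rcases le_abs.1 hω with h | h <;> nlinarith

/-- The normalized errors of an asymptotically linear sequence are tight. -/
lemma IsAsymptoticallyLinear.tight {μ : Measure ℝ} {A : ℕ → Ω → ℝ} {a : ℝ} {φ : ℝ → ℝ}
    (hA : IsAsymptoticallyLinear P X A a φ)
    (hX : ∀ i, HasLaw (X i) μ P) (hind : iIndepFun X P)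
    (hφ : Measurable φ) (h2 : MemLp φ 2 μ) (h0 : ∫ x, φ x ∂μ = 0) {κ : ℝ} (hκ : 0 < κ) :
    ∃ M : ℝ, 0 < M ∧ ∀ᶠ n : ℕ in atTop, P.real {ω | M ≤ |√(n : ℝ) * (A n ω - a)|} < κ := by
  rw [isAsymptoticallyLinear_iff] at hA
  have hlim : Tendsto (fun c : ℝ => (∫ x, φ x ^ 2 ∂μ) / c ^ 2) atTop (𝓝 0) :=
    tendsto_const_nhds.div_atTop (tendsto_pow_atTop two_ne_zero)
  obtain ⟨M, hM, hM0⟩ := ((hlim.eventually_lt_const (half_pos hκ)).and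
    (eventually_gt_atTop 0)).exists
  refine ⟨M + 1, by linarith, ?_⟩
  filter_upwards [(hA 1 one_pos).eventually_lt_const (half_pos hκ)] with n hn
  have hc := measureReal_le_abs_normalizedSum hX hind hφ h2 h0 hM0 n
  refine ((measureReal_mono ?_).trans (measureReal_union_le
    {ω | 1 ≤ |√(n : ℝ) * (A n ω - a) - normalizedSum φ X n ω|}
    {ω | M ≤ |normalizedSum φ X n ω|})).trans_lt (by linarith)
  intro ω hω
  by_contra hcon
  simp only [Set.mem_union, Set.mem_ofPred_eq, not_or, not_le] at hcon hω
  have h1 := abs_lt.1 hcon.1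
  have h2 := abs_lt.1 hcon.2
  rcases le_abs.1 hω with h | h <;> linarith

/-! ### The Bahadur representation of sample quantiles -/

/-- Near `q` the empirical process has increments of smaller order:
`√n (F_n(q + t/√n) - F_n(q)) → d t` in probability if `F` has derivative `d` at `q`. -/
lemma tendsto_measureReal_empiricalCDF_increment {μ : Measure ℝ} [IsProbabilityMeasure μ]
    (hX : ∀ i, HasLaw (X i) μ P)
    (hind : iIndepFun X P) {q d : ℝ} (hd : HasDerivAt (cdf μ) d q) (t : ℝ) {ε : ℝ} (hε : 0 < ε) :
    Tendsto (fun n : ℕ => P.real {ω | ε ≤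
      |√(n : ℝ) * (empiricalCDF (fun i => X i ω) n (q + t / √(n : ℝ)) -
        empiricalCDF (fun i => X i ω) n q) - d * t|}) atTop (𝓝 0) := by
  have hsqrt : Tendsto (fun n : ℕ => √(n : ℝ)) atTop atTop :=
    Real.tendsto_sqrt_atTop.comp tendsto_natCast_atTop_atTop
  have hh : Tendsto (fun n : ℕ => t / √(n : ℝ)) atTop (𝓝 0) := tendsto_const_nhds.div_atTop hsqrt
  have hq : Tendsto (fun n : ℕ => q + t / √(n : ℝ)) atTop (𝓝 q) := by
    simpa using hh.const_add q
  set Δ : ℕ → ℝ := fun n => cdf μ (q + t / √(n : ℝ)) - cdf μ q with hΔ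
  have hΔ0 : Tendsto Δ atTop (𝓝 0) := by
    simpa using (hd.continuousAt.tendsto.comp hq).sub_const (cdf μ q)
  have hΔ1 : Tendsto (fun n : ℕ => √(n : ℝ) * Δ n) atTop (𝓝 (d * t)) := by
    have hlin : HasDerivAt (fun s : ℝ => q + s * t) t 0 := by
      simpa using ((hasDerivAt_id (0 : ℝ)).mul_const t).const_add q
    have hcomp : HasDerivAt (fun s : ℝ => cdf μ (q + s * t)) (d * t) 0 :=
      HasDerivAt.comp (h₂ := cdf μ) (0 : ℝ) (by simpa using hd) hlin
    have hs := hasDerivAt_iff_tendsto_slope.1 hcomp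
    have hinv : Tendsto (fun n : ℕ => (√(n : ℝ))⁻¹) atTop (𝓝[≠] 0) :=
      tendsto_nhdsWithin_iff.2 ⟨tendsto_inv_atTop_zero.comp hsqrt, by
        filter_upwards [eventually_gt_atTop 0] with n hn
        have : (0 : ℝ) < n := Nat.cast_pos.2 hn
        simpa using hn.ne'⟩
    refine (hs.comp hinv).congr fun n => ?_
    simp [slope_def_field, hΔ, div_eq_mul_inv, mul_comm]
  -- The increment of `F_n` is the empirical mean of `η n`.
  set η : ℕ → ℝ → ℝ := fun n x => pointMassCDF x (q + t / √(n : ℝ)) - pointMassCDF x q with hη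
  have hηm : ∀ n, Measurable (η n) := fun n =>
    (measurable_pointMassCDF _).sub (measurable_pointMassCDF _)
  have hηi : ∀ n, ∫ x, η n x ∂μ = Δ n := fun n => by
    simp only [hη]
    rw [integral_sub (integrable_pointMassCDF μ _) (integrable_pointMassCDF μ _),
      integral_pointMassCDF, integral_pointMassCDF]
  have hηb : ∀ n x, |η n x| ≤ 1 := fun n x => by
    have := pointMassCDF_nonneg x (q + t / √(n : ℝ))
    have := pointMassCDF_le_one x (q + t / √(n : ℝ))
    have := pointMassCDF_nonneg x q
    have := pointMassCDF_le_one x q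
    rw [abs_le]; constructor <;> simp only [hη] <;> linarith
  have hηL : ∀ n, MemLp (η n) 2 μ := fun n =>
    MemLp.of_bound (hηm n).aestronglyMeasurable 1 (ae_of_all _ (hηb n))
  -- Since `η n` is, up to sign, an indicator, its second moment is `|Δ n|`.
  have hηsq : ∀ n, ∫ x, η n x ^ 2 ∂μ = |Δ n| := fun n => by
    rcases le_total q (q + t / √(n : ℝ)) with hle | hle
    · have h1 : ∀ x, η n x ^ 2 = η n x := fun x => by
        have := monotone_pointMassCDF x hle
        simp only [hη, pointMassCDF] at *
        split_ifs at * <;> norm_num at *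
      simp_rw [h1, hηi]
      exact (abs_of_nonneg (sub_nonneg.2 (monotone_cdf μ hle))).symm
    · have h1 : ∀ x, η n x ^ 2 = -η n x := fun x => by
        have := monotone_pointMassCDF x hle
        simp only [hη, pointMassCDF] at *
        split_ifs at * <;> norm_num at *
      simp_rw [h1, integral_neg, hηi]
      exact (abs_of_nonpos (sub_nonpos.2 (monotone_cdf μ hle))).symm
  set χ : ℕ → ℝ → ℝ := fun n x => η n x - Δ n with hχ
  have hχm : ∀ n, Measurable (χ n) := fun n => (hηm n).sub_const _
  have hχL : ∀ n, MemLp (χ n) 2 μ := fun n => (hηL n).sub (memLp_const _)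
  have hχ0 : ∀ n, ∫ x, χ n x ∂μ = 0 := fun n => by
    simp only [hχ]
    rw [integral_sub ((hηL n).integrable one_le_two) (integrable_const _), hηi]
    simp
  have hχsq : ∀ n, ∫ x, χ n x ^ 2 ∂μ ≤ |Δ n| := fun n => by
    rw [← variance_of_integral_eq_zero (hχm n).aemeasurable (hχ0 n), ← hηsq n]
    simp only [hχ]
    rw [variance_sub_const (hηm n).aestronglyMeasurable]
    exact variance_le_expectation_sq (hηm n).aestronglyMeasurable
  have hbound : Tendsto (fun n => |Δ n| / (ε / 2) ^ 2) atTop (𝓝 0) := by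
    simpa using hΔ0.abs.div_const ((ε / 2) ^ 2)
  refine squeeze_zero' (Eventually.of_forall fun n => measureReal_nonneg) ?_ hbound
  have hdet := (hΔ1.sub_const (d * t)).abs
  rw [sub_self, abs_zero] at hdet
  filter_upwards [hdet.eventually_lt_const (half_pos hε), eventually_gt_atTop 0] with n hn hn0
  have hnpos : (0 : ℝ) < n := Nat.cast_pos.2 hn0
  have hspos : 0 < √(n : ℝ) := Real.sqrt_pos.2 hnpos
  refine le_trans (measureReal_mono ?_)
    ((measureReal_le_abs_normalizedSum hX hind (hχm n) (hχL n) (hχ0 n) (half_pos hε) n).trans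
      (div_le_div_of_nonneg_right (hχsq n) (by positivity)))
  intro ω hω
  simp only [Set.mem_ofPred_eq] at hω ⊢
  have hrep : √(n : ℝ) * (empiricalCDF (fun i => X i ω) n (q + t / √(n : ℝ)) -
        empiricalCDF (fun i => X i ω) n q) = normalizedSum (χ n) X n ω + √(n : ℝ) * Δ n := by
    simp only [normalizedSum, hχ, hη, empiricalCDF, Finset.sum_sub_distrib, Finset.sum_const,
      Finset.card_range, nsmul_eq_mul]
    rw [mul_sub, sqrt_mul_div_self, sqrt_mul_div_self, mul_sub, mul_sub, ← mul_assoc _ (n : ℝ),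
      inv_sqrt_mul_self]
    ring
  rw [hrep] at hω
  have h1 := abs_lt.1 hn
  rcases le_abs.1 hω with h | h
  · exact le_abs.2 (Or.inl (by linarith [h1.2]))
  · exact le_abs.2 (Or.inr (by linarith [h1.1]))

/-- **Bahadur representation**: if `F` has a positive derivative at the `p`-th quantile then the
sample quantile is asymptotically linear, with the influence function of the quantile. -/
lemma isAsymptoticallyLinear_quantile {μ : Measure ℝ} [IsProbabilityMeasure μ]
    (hX : ∀ i, HasLaw (X i) μ P) (hind : iIndepFun X P)
    {p q d : ℝ} (hp0 : 0 < p) (hp1 : p < 1) (hd0 : 0 < d) (hd : HasDerivAt (cdf μ) d q)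
    (hq : cdf μ q = p) :
    IsAsymptoticallyLinear P X (fun n ω => quantile (empiricalCDF (fun i => X i ω) n) p) q
      (quantileInfluence p q (1 / d)) := by
  rw [isAsymptoticallyLinear_iff]
  intro ε hε
  set φ := quantileInfluence p q (1 / d) with hφ
  have hφm : Measurable φ := measurable_quantileInfluence _ _ _
  have hφL : MemLp φ 2 μ := memLp_quantileInfluence hp0 hp1 _ _
  have hφ0 : ∫ x, φ x ∂μ = 0 := integral_quantileInfluence hq _
  set D : ℝ → ℕ → Ω → ℝ := fun t n ω =>
    √(n : ℝ) * (empiricalCDF (fun i => X i ω) n (q + t / √(n : ℝ)) -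
        empiricalCDF (fun i => X i ω) n q) - d * t with hD
  rw [Metric.tendsto_nhds]
  intro κ hκ
  have hlim : Tendsto (fun c : ℝ => (∫ x, φ x ^ 2 ∂μ) / c ^ 2) atTop (𝓝 0) :=
    tendsto_const_nhds.div_atTop (tendsto_pow_atTop two_ne_zero)
  obtain ⟨M, hM, hM0⟩ := ((hlim.eventually_lt_const (half_pos hκ)).and
    (eventually_gt_atTop 0)).exists
  -- On a grid of mesh `δ` covering `[-M, M]`, the increments `D` are all small.
  set δ := ε / 3 with hδ
  have hδ0 : 0 < δ := by positivity
  -- The `3` leaves room for grid points up to `2 δ` beyond `[-M, M]`.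
  obtain ⟨K, hK⟩ := exists_nat_gt (M / δ + 3)
  have hgrid : Tendsto (fun n : ℕ => ∑ k ∈ Finset.Icc (-(K : ℤ)) K,
      P.real {ω | d * δ ≤ |D (k * δ) n ω|}) atTop (𝓝 0) := by
    simpa using tendsto_finsetSum (Finset.Icc (-(K : ℤ)) K) fun k _ =>
      tendsto_measureReal_empiricalCDF_increment hX hind hd (k * δ) (mul_pos hd0 hδ0)
  filter_upwards [hgrid.eventually_lt_const (half_pos hκ), eventually_gt_atTop 0] with n hn hn0
  have hnpos : (0 : ℝ) < n := Nat.cast_pos.2 hn0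
  have hspos : 0 < √(n : ℝ) := Real.sqrt_pos.2 hnpos
  have hc := measureReal_le_abs_normalizedSum hX hind hφm hφL hφ0 hM0 n
  rw [Real.dist_eq, sub_zero, abs_of_nonneg measureReal_nonneg]
  refine ((measureReal_mono ?_).trans ((measureReal_union_le {ω | M ≤ |normalizedSum φ X n ω|}
    (⋃ k ∈ Finset.Icc (-(K : ℤ)) K, {ω | d * δ ≤ |D (k * δ) n ω|})).trans
    (add_le_add le_rfl (measureReal_biUnion_finset_le _ _)))).trans_lt
    (by linarith : _ < κ)
  intro ω hω
  by_contra hcon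
  simp only [Set.mem_union, Set.mem_iUnion, Set.mem_ofPred_eq, not_or, not_le,
    not_exists] at hcon hω
  obtain ⟨hW, hDk⟩ := hcon
  set W := normalizedSum φ X n ω with hWdef
  set Fn := empiricalCDF (fun i => X i ω) n with hFn
  have hWM := abs_lt.1 hW
  have hdW : d * W = √(n : ℝ) * (p - Fn q) := by
    simp only [hWdef, hFn, normalizedSum, hφ, quantileInfluence, empiricalCDF, ← Finset.sum_mul,
      Finset.sum_sub_distrib, Finset.sum_const, Finset.card_range, nsmul_eq_mul]
    rw [mul_sub, sqrt_mul_div_self, ← mul_assoc _ _ (1 / d), mul_sub, ← mul_assoc _ (n : ℝ),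
      inv_sqrt_mul_self]
    field_simp
  -- Hence the sign of `F_n(q + t/√n) - p` is that of `t - W` for grid points `t` at distance at
  -- least `δ` from `W`.
  have hexp : ∀ t, √(n : ℝ) * (Fn (q + t / √(n : ℝ)) - p) = D t n ω + d * (t - W) := fun t => by
    rw [mul_sub d, hdW]; simp only [hD]; ring
  have hmem : ∀ k : ℤ, |(k : ℝ)| * δ < M + 3 * δ → |D (k * δ) n ω| < d * δ := fun k hk => by
    refine hDk k (Finset.mem_Icc.2 (abs_le.1 ?_))
    have h1 : |(k : ℝ)| < K := by
      refine lt_trans ?_ hK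
      rw [← lt_div_iff₀ hδ0] at hk
      refine hk.trans_eq ?_
      field_simp
    exact_mod_cast h1.le
  -- The grid points `u δ`, `l δ` next to `W` at distance at least `δ` bracket `√n (Q_n - q)`.
  set u : ℤ := ⌈W / δ⌉ + 1 with hu
  set l : ℤ := ⌊W / δ⌋ - 1 with hl
  have hu1 : W + δ ≤ u * δ := by
    have := Int.le_ceil (W / δ)
    rw [div_le_iff₀ hδ0] at this
    rw [hu]; push_cast; linarith
  have hu2 : u * δ < W + 2 * δ := by
    have := Int.ceil_lt_add_one (W / δ)
    have := mul_lt_mul_of_pos_right this hδ0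
    rw [add_mul, div_mul_cancel₀ _ hδ0.ne'] at this
    rw [hu]; push_cast; linarith
  have hl1 : l * δ ≤ W - δ := by
    have := Int.floor_le (W / δ)
    rw [le_div_iff₀ hδ0] at this
    rw [hl]; push_cast; linarith
  have hl2 : W - 2 * δ < l * δ := by
    have := Int.lt_floor_add_one (W / δ)
    have := mul_lt_mul_of_pos_right this hδ0
    rw [add_mul, div_mul_cancel₀ _ hδ0.ne'] at this
    rw [hl]; push_cast; linarith
  have habs : ∀ k : ℤ, |(k : ℝ)| * δ = |(k : ℝ) * δ| := fun k => by
    rw [abs_mul, abs_of_pos hδ0]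
  have hDu := abs_lt.1 (hmem u (by rw [habs, abs_lt]; constructor <;> linarith))
  have hDl := abs_lt.1 (hmem l (by rw [habs, abs_lt]; constructor <;> linarith))
  have hup : p ≤ Fn (q + u * δ / √(n : ℝ)) := by
    have h1 := hexp (u * δ)
    have h2 : d * δ ≤ d * (u * δ - W) := mul_le_mul_of_nonneg_left (by linarith) hd0.le
    have h3 : 0 < √(n : ℝ) * (Fn (q + u * δ / √(n : ℝ)) - p) := by linarith [hDu.1]
    linarith [(mul_pos_iff_of_pos_left hspos).1 h3]
  have hlo : Fn (q + l * δ / √(n : ℝ)) < p := by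
    have h1 := hexp (l * δ)
    have h2 : d * (l * δ - W) ≤ d * (-δ) := mul_le_mul_of_nonneg_left (by linarith) hd0.le
    have h3 : 0 < √(n : ℝ) * (p - Fn (q + l * δ / √(n : ℝ))) := by linarith [hDl.2]
    linarith [(mul_pos_iff_of_pos_left hspos).1 h3]
  have hmono : Monotone Fn := monotone_empiricalCDF _ _
  have e1 := le_quantile hmono hlo hup
  have e2 := quantile_le hmono hlo hup
  have e3 : l * δ ≤ √(n : ℝ) * (quantile Fn p - q) := by
    rw [← div_le_iff₀' hspos]; linarith
  have e4 : √(n : ℝ) * (quantile Fn p - q) ≤ u * δ := by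
    rw [← le_div_iff₀' hspos]; linarith
  rcases le_abs.1 hω with h | h <;> linarith

end Sample


/-! ### A two-sample central limit theorem -/

lemma norm_pow_sub_pow_le_of_norm_le_one {z w : ℂ} (hz : ‖z‖ ≤ 1) (hw : ‖w‖ ≤ 1) (n : ℕ) :
    ‖z ^ n - w ^ n‖ ≤ n * ‖z - w‖ := by
  induction n with
  | zero => simp
  | succ n ih =>
    have : z ^ (n + 1) - w ^ (n + 1) = (z ^ n - w ^ n) * z + w ^ n * (z - w) := by ring
    rw [this]
    calc ‖(z ^ n - w ^ n) * z + w ^ n * (z - w)‖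
        ≤ ‖z ^ n - w ^ n‖ * ‖z‖ + ‖w‖ ^ n * ‖z - w‖ := by
          refine (norm_add_le _ _).trans ?_
          rw [norm_mul, norm_mul, norm_pow]
      _ ≤ (n * ‖z - w‖) * 1 + 1 * ‖z - w‖ := by
          gcongr
          exact pow_le_one₀ (norm_nonneg _) hw
      _ = ((n + 1 : ℕ) : ℝ) * ‖z - w‖ := by push_cast; ring

lemma charFun_stdGaussian_real (t : ℝ) :
    charFun (gaussianReal 0 1) t = Complex.exp (-(t : ℂ) ^ 2 / 2) := by
  rw [charFun_gaussianReal]; congr 1; simp; ring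

lemma charFun_stdGaussian_real_pow {n : ℕ} (hn : 0 < n) (a : ℝ) :
    charFun (gaussianReal 0 1) ((√(n : ℝ))⁻¹ * a) ^ n = charFun (gaussianReal 0 1) a := by
  rw [charFun_stdGaussian_real, charFun_stdGaussian_real, ← Complex.exp_nat_mul]
  congr 1
  have hn' : (n : ℂ) ≠ 0 := Nat.cast_ne_zero.2 hn.ne'
  have hs : ((√(n : ℝ) : ℝ) : ℂ) ^ 2 = n := by
    rw [← Complex.ofReal_pow, Real.sq_sqrt (Nat.cast_nonneg n)]; simp
  push_cast
  rw [mul_pow, inv_pow, hs]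
  field_simp

/-- The characteristic functions of normalized sums of a standardized law `ν` approach the Gaussian
one uniformly on bounded sets: both have the same second order expansion at `0`, so
`|φ(a/√n)^n - φ_G(a/√n)^n| ≤ n |φ(a/√n) - φ_G(a/√n)| = n o(a²/n)`. -/
lemma tendsto_charFun_pow_sub_gaussian {ν : Measure ℝ} [IsProbabilityMeasure ν]
    (h0 : ∫ x, x ∂ν = 0) (h1 : ∫ x, x ^ 2 ∂ν = 1) {ι : Type*} {l : Filter ι} {m : ι → ℕ}
    (hm : Tendsto m l atTop) {a : ι → ℝ} {C : ℝ} (ha : ∀ᶠ i in l, |a i| ≤ C) :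
    Tendsto (fun i => charFun ν ((√(m i : ℝ))⁻¹ * a i) ^ m i - charFun (gaussianReal 0 1) (a i))
      l (𝓝 0) := by
  have e1 := taylor_charFun_two (P := ν) (X := id) aemeasurable_id (by simpa using h0)
    (by simpa using h1)
  have e2 := taylor_charFun_two (P := gaussianReal 0 1) (X := id) aemeasurable_id
    (by simp [integral_id_gaussianReal]) (by
      have := variance_of_integral_eq_zero (μ := gaussianReal 0 1) (X := id) aemeasurable_id
        (by simp [integral_id_gaussianReal])
      rw [variance_id_gaussianReal] at this
      simpa using this.symm)
  rw [Measure.map_id] at e1 e2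
  have e3 := e1.sub e2
  simp only [sub_sub_sub_cancel_right] at e3
  have hu : Tendsto (fun i => (√(m i : ℝ))⁻¹ * a i) l (𝓝 0) := by
    have hs : Tendsto (fun i => (√(m i : ℝ))⁻¹) l (𝓝 0) :=
      tendsto_inv_atTop_zero.comp
        (Real.tendsto_sqrt_atTop.comp (tendsto_natCast_atTop_atTop.comp hm))
    rw [tendsto_zero_iff_norm_tendsto_zero] at hs ⊢
    have hs' := hs.mul_const C
    rw [zero_mul] at hs'
    refine squeeze_zero' (Eventually.of_forall fun i => norm_nonneg _) ?_ hs'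
    filter_upwards [ha] with i hi
    rw [norm_mul]
    exact mul_le_mul_of_nonneg_left hi (norm_nonneg _)
  rw [Metric.tendsto_nhds]
  intro ε hε
  set ε' := ε / (C ^ 2 + 1) with hε'
  have hε'0 : 0 < ε' := by positivity
  filter_upwards [hu.eventually (e3.bound hε'0), ha, hm.eventually_gt_atTop 0] with i hi hai hmi
  have hmpos : (0 : ℝ) < m i := Nat.cast_pos.2 hmi
  rw [dist_zero_right, ← charFun_stdGaussian_real_pow hmi (a i)]
  refine (norm_pow_sub_pow_le_of_norm_le_one (norm_charFun_le_one _) (norm_charFun_le_one _)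
    _).trans_lt ?_
  calc (m i : ℝ) * ‖charFun ν ((√(m i : ℝ))⁻¹ * a i)
          - charFun (gaussianReal 0 1) ((√(m i : ℝ))⁻¹ * a i)‖
      ≤ m i * (ε' * ‖((√(m i : ℝ))⁻¹ * a i) ^ 2‖) := by gcongr
    _ = ε' * a i ^ 2 := by
        rw [Real.norm_of_nonneg (sq_nonneg _), mul_pow, inv_pow, Real.sq_sqrt hmpos.le]
        field_simp
    _ ≤ ε' * C ^ 2 := by
        gcongr ε' * ?_
        exact sq_le_sq' (by linarith [neg_abs_le (a i)]) ((le_abs_self _).trans hai)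
    _ < ε := by
        rw [hε', div_mul_eq_mul_div, div_lt_iff₀ (by positivity)]
        nlinarith

lemma measurable_sum_eval {φ : ℝ → ℝ} (hφ : Measurable φ) (n : ℕ) :
    Measurable fun x : ℕ → ℝ => (√(n : ℝ))⁻¹ * ∑ i ∈ Finset.range n, φ (x i) :=
  (Finset.measurable_sum _ fun i _ => hφ.comp (measurable_pi_apply i)).const_mul _

lemma charFun_map_mul_normalizedSum {Ω : Type*} [MeasurableSpace Ω] {P : Measure Ω}
    {μ : Measure ℝ} {X : ℕ → Ω → ℝ} (hX : ∀ i, HasLaw (X i) μ P) (hind : iIndepFun X P)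
    {φ : ℝ → ℝ} (hφ : Measurable φ) (n : ℕ) (c t : ℝ) :
    charFun (P.map fun ω => c * normalizedSum φ X n ω) t
      = charFun (μ.map φ) ((√(n : ℝ))⁻¹ * (c * t)) ^ n := by
  have hm : ∀ i, AEMeasurable (fun ω => φ (X i ω)) P := fun i =>
    hφ.comp_aemeasurable (hX i).aemeasurable
  have hmap : ∀ i, P.map (fun ω => φ (X i ω)) = μ.map φ := fun i => by
    rw [← (hX i).map_eq, AEMeasurable.map_map_of_aemeasurable hφ.aemeasurable (hX i).aemeasurable]
    rfl
  rw [charFun_map_mul_comp (aemeasurable_normalizedSum hX hφ n)]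
  have := charFun_inv_sqrt_mul_sum (P := P) (X := fun i ω => φ (X i ω)) (n := n) (t := c * t)
    (hind.comp (fun _ => φ) fun _ => hφ)
    (fun i => ⟨hm i, hm 0, by rw [hmap, hmap]⟩)
  rw [hmap] at this
  exact this

section TwoSample

variable {Ω : Type*} [MeasurableSpace Ω] {P : Measure Ω} [IsProbabilityMeasure P]
  {μ₁ μ₂ : Measure ℝ} [IsProbabilityMeasure μ₁] [IsProbabilityMeasure μ₂] {X Y : ℕ → Ω → ℝ}

/-- Two-sample central limit theorem, for standardized summands. The weights `α`, `β` may vary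
arbitrarily on the unit circle, since the characteristic functions converge uniformly on bounded
sets. -/
lemma tendstoInDistribution_add_normalizedSum_of_standard
    (hX : ∀ i, HasLaw (X i) μ₁ P) (hY : ∀ i, HasLaw (Y i) μ₂ P)
    (hXind : iIndepFun X P) (hYind : iIndepFun Y P)
    (hXY : IndepFun (fun ω i => X i ω) (fun ω i => Y i ω) P)
    {φ ψ : ℝ → ℝ} (hφ : Measurable φ) (hψ : Measurable ψ)
    (hφ0 : ∫ x, φ x ∂μ₁ = 0) (hψ0 : ∫ y, ψ y ∂μ₂ = 0)
    (hφ1 : ∫ x, φ x ^ 2 ∂μ₁ = 1) (hψ1 : ∫ y, ψ y ^ 2 ∂μ₂ = 1)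
    {α β : ℕ × ℕ → ℝ} (hαβ : ∀ᶠ n in atTop ×ˢ atTop, α n ^ 2 + β n ^ 2 = 1) :
    TendstoInDistribution
      (fun (n : ℕ × ℕ) ω => α n * normalizedSum φ X n.1 ω + β n * normalizedSum ψ Y n.2 ω)
      (atTop ×ˢ atTop) (id : ℝ → ℝ) (fun _ => P) (gaussianReal 0 1) := by
  have hmX : ∀ n : ℕ × ℕ, AEMeasurable (fun ω => α n * normalizedSum φ X n.1 ω) P := fun n =>
    (aemeasurable_normalizedSum hX hφ n.1).const_mul _
  have hmY : ∀ n : ℕ × ℕ, AEMeasurable (fun ω => β n * normalizedSum ψ Y n.2 ω) P := fun n =>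
    (aemeasurable_normalizedSum hY hψ n.2).const_mul _
  have hν₁ : IsProbabilityMeasure (μ₁.map φ) := Measure.isProbabilityMeasure_map hφ.aemeasurable
  have hν₂ : IsProbabilityMeasure (μ₂.map ψ) := Measure.isProbabilityMeasure_map hψ.aemeasurable
  refine ⟨fun n => (hmX n).add (hmY n), aemeasurable_id, ?_⟩
  -- Lévy's convergence theorem is available for sequences only.
  refine tendsto_of_seq_tendsto fun u hu => ?_
  refine ProbabilityMeasure.tendsto_iff_tendsto_charFun.2 fun t => ?_
  have hchar : ∀ n : ℕ × ℕ, charFun (P.map fun ω =>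
      α n * normalizedSum φ X n.1 ω + β n * normalizedSum ψ Y n.2 ω) t
      = charFun (μ₁.map φ) ((√(n.1 : ℝ))⁻¹ * (α n * t)) ^ n.1
        * charFun (μ₂.map ψ) ((√(n.2 : ℝ))⁻¹ * (β n * t)) ^ n.2 := fun n => by
    have hi : IndepFun (fun ω => α n * normalizedSum φ X n.1 ω)
        (fun ω => β n * normalizedSum ψ Y n.2 ω) P :=
      hXY.comp ((measurable_sum_eval hφ n.1).const_mul (α n))
        ((measurable_sum_eval hψ n.2).const_mul (β n))
    rw [hi.charFun_map_fun_add_eq_mul (hmX n) (hmY n), Pi.mul_apply,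
      charFun_map_mul_normalizedSum hX hXind hφ, charFun_map_mul_normalizedSum hY hYind hψ]
  have hu' : ∀ᶠ k in atTop, α (u k) ^ 2 + β (u k) ^ 2 = 1 := hu.eventually hαβ
  have hl₁ := tendsto_charFun_pow_sub_gaussian (ν := μ₁.map φ)
    (by rw [integral_map hφ.aemeasurable (by fun_prop)]; exact hφ0)
    (by rw [integral_map hφ.aemeasurable (by fun_prop)]; exact hφ1)
    (tendsto_fst.comp hu) (a := fun k => α (u k) * t) (C := |t|) (by
      filter_upwards [hu'] with k hk
      rw [abs_mul]
      exact mul_le_of_le_one_left (abs_nonneg t) (abs_le_one_iff_mul_self_le_one.2 (by nlinarith)))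
  have hl₂ := tendsto_charFun_pow_sub_gaussian (ν := μ₂.map ψ)
    (by rw [integral_map hψ.aemeasurable (by fun_prop)]; exact hψ0)
    (by rw [integral_map hψ.aemeasurable (by fun_prop)]; exact hψ1)
    (tendsto_snd.comp hu) (a := fun k => β (u k) * t) (C := |t|) (by
      filter_upwards [hu'] with k hk
      rw [abs_mul]
      exact mul_le_of_le_one_left (abs_nonneg t) (abs_le_one_iff_mul_self_le_one.2 (by nlinarith)))
  rw [tendsto_iff_norm_sub_tendsto_zero]
  have hlim := hl₁.norm.add hl₂.norm
  rw [norm_zero, add_zero] at hlim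
  refine squeeze_zero' (Eventually.of_forall fun k => norm_nonneg _) ?_ hlim
  filter_upwards [hu'] with k hk
  have hG : charFun (gaussianReal 0 1) t
      = charFun (gaussianReal 0 1) (α (u k) * t) * charFun (gaussianReal 0 1) (β (u k) * t) := by
    rw [charFun_stdGaussian_real, charFun_stdGaussian_real, charFun_stdGaussian_real,
      ← Complex.exp_add]
    congr 1
    have : (α (u k) : ℂ) ^ 2 + (β (u k) : ℂ) ^ 2 = 1 := by exact_mod_cast hk
    push_cast
    linear_combination (-(t : ℂ) ^ 2 / 2) * (-this)
  simp only [ProbabilityMeasure.coe_mk, Measure.map_id, Function.comp_apply]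
  change ‖charFun (P.map fun ω => α (u k) * normalizedSum φ X (u k).1 ω
    + β (u k) * normalizedSum ψ Y (u k).2 ω) t - charFun (gaussianReal 0 1) t‖ ≤ _
  rw [hchar, hG]
  set z := charFun (μ₁.map φ) ((√((u k).1 : ℝ))⁻¹ * (α (u k) * t)) ^ (u k).1
  set w := charFun (μ₂.map ψ) ((√((u k).2 : ℝ))⁻¹ * (β (u k) * t)) ^ (u k).2 with hw
  set z' := charFun (gaussianReal 0 1) (α (u k) * t) with hz'
  set w' := charFun (gaussianReal 0 1) (β (u k) * t)
  have hw1 : ‖w‖ ≤ 1 := by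
    rw [hw, norm_pow]
    exact pow_le_one₀ (norm_nonneg _) (norm_charFun_le_one _)
  have hz1 : ‖z'‖ ≤ 1 := norm_charFun_le_one _
  calc ‖z * w - z' * w'‖ = ‖(z - z') * w + z' * (w - w')‖ := by congr 1; ring
    _ ≤ ‖z - z'‖ * ‖w‖ + ‖z'‖ * ‖w - w'‖ := by
        refine (norm_add_le _ _).trans ?_
        rw [norm_mul, norm_mul]
    _ ≤ ‖z - z'‖ * 1 + 1 * ‖w - w'‖ := by gcongr
    _ = ‖z - z'‖ + ‖w - w'‖ := by ring

/-- Two-sample central limit theorem: sums with weights that make the total variance `1`. -/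
lemma tendstoInDistribution_add_normalizedSum
    (hX : ∀ i, HasLaw (X i) μ₁ P) (hY : ∀ i, HasLaw (Y i) μ₂ P)
    (hXind : iIndepFun X P) (hYind : iIndepFun Y P)
    (hXY : IndepFun (fun ω i => X i ω) (fun ω i => Y i ω) P)
    {φ ψ : ℝ → ℝ} (hφ : Measurable φ) (hψ : Measurable ψ)
    (hφ0 : ∫ x, φ x ∂μ₁ = 0) (hψ0 : ∫ y, ψ y ∂μ₂ = 0)
    (hφ1 : 0 < ∫ x, φ x ^ 2 ∂μ₁) (hψ1 : 0 < ∫ y, ψ y ^ 2 ∂μ₂) {α β : ℕ × ℕ → ℝ}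
    (hαβ : ∀ᶠ n in atTop ×ˢ atTop,
      α n ^ 2 * (∫ x, φ x ^ 2 ∂μ₁) + β n ^ 2 * (∫ y, ψ y ^ 2 ∂μ₂) = 1) :
    TendstoInDistribution
      (fun (n : ℕ × ℕ) ω => α n * normalizedSum φ X n.1 ω + β n * normalizedSum ψ Y n.2 ω)
      (atTop ×ˢ atTop) (id : ℝ → ℝ) (fun _ => P) (gaussianReal 0 1) := by
  set σ₁ := √(∫ x, φ x ^ 2 ∂μ₁) with hσ₁
  set σ₂ := √(∫ y, ψ y ^ 2 ∂μ₂) with hσ₂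
  have h1 : 0 < σ₁ := Real.sqrt_pos.2 hφ1
  have h2 : 0 < σ₂ := Real.sqrt_pos.2 hψ1
  have hs1 : σ₁ ^ 2 = ∫ x, φ x ^ 2 ∂μ₁ := Real.sq_sqrt hφ1.le
  have hs2 : σ₂ ^ 2 = ∫ y, ψ y ^ 2 ∂μ₂ := Real.sq_sqrt hψ1.le
  have key := tendstoInDistribution_add_normalizedSum_of_standard hX hY hXind hYind hXY
    (φ := fun x => φ x / σ₁) (ψ := fun y => ψ y / σ₂) (hφ.div_const _) (hψ.div_const _)
    (by rw [integral_div, hφ0, zero_div]) (by rw [integral_div, hψ0, zero_div])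
    (by simp_rw [div_pow]; rw [integral_div, ← hs1]; exact div_self (by positivity))
    (by simp_rw [div_pow]; rw [integral_div, ← hs2]; exact div_self (by positivity))
    (α := fun n => α n * σ₁) (β := fun n => β n * σ₂)
    (by filter_upwards [hαβ] with n hn; rw [mul_pow, mul_pow, hs1, hs2, hn])
  have e : (fun (n : ℕ × ℕ) (ω : Ω) => α n * normalizedSum φ X n.1 ω
        + β n * normalizedSum ψ Y n.2 ω)
      = fun n ω => α n * σ₁ * normalizedSum (fun x => φ x / σ₁) X n.1 ω
        + β n * σ₂ * normalizedSum (fun y => ψ y / σ₂) Y n.2 ω := by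
    ext n ω
    simp only [normalizedSum, ← Finset.sum_div]
    field_simp
  rw [e]
  exact key

end TwoSample


/-! ### The delta method for functionals of two distributions -/

/-- The statistical functional `S` has, at the distribution function of `μ`, the square integrable
influence function `φ` with mean zero and positive variance, and the plug-in estimator of `S` based
on the sample `X` is measurable and asymptotically linear with influence function `φ`. -/
structure HasInfluenceExpansion {Ω : Type*} [MeasurableSpace Ω] (P : Measure Ω) (X : ℕ → Ω → ℝ)
    (μ : Measure ℝ) (S : (ℝ → ℝ) → ℝ) (φ : ℝ → ℝ) : Prop where
  hasInfluence : ∀ᵐ x ∂μ, HasInfluence S (cdf μ) x (φ x)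
  measurable : Measurable φ
  memLp : MemLp φ 2 μ
  integral_eq_zero : ∫ x, φ x ∂μ = 0
  integral_sq_pos : 0 < ∫ x, φ x ^ 2 ∂μ
  measurable_plugin : ∀ n, Measurable fun x : ℕ → ℝ => S (empiricalCDF x n)
  isAsymptoticallyLinear :
    IsAsymptoticallyLinear P X (fun n ω => S (empiricalCDF (fun i => X i ω) n)) (S (cdf μ)) φ

/-- Chain rule for partial influence functions. -/
lemma isInfluenceASV_comp {Ω : Type*} [MeasurableSpace Ω] {P : Measure Ω} {X Y : ℕ → Ω → ℝ}
    {μ₁ μ₂ : Measure ℝ} {S : (ℝ → ℝ) → ℝ} {φ ψ : ℝ → ℝ} (hφ : HasInfluenceExpansion P X μ₁ S φ)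
    (hψ : HasInfluenceExpansion P Y μ₂ S ψ) {h : ℝ × ℝ → ℝ} {c₁ c₂ : ℝ}
    (hh : HasFDerivAt h (c₁ • ContinuousLinearMap.fst ℝ ℝ ℝ + c₂ • ContinuousLinearMap.snd ℝ ℝ ℝ)
      (S (cdf μ₁), S (cdf μ₂))) {w₁ w₂ V : ℝ}
    (hV : V = 1 / w₁ * (c₁ ^ 2 * ∫ x, φ x ^ 2 ∂μ₁) + 1 / w₂ * (c₂ ^ 2 * ∫ y, ψ y ^ 2 ∂μ₂)) :
    IsInfluenceASV (fun F G => h (S F, S G)) μ₁ μ₂ w₁ w₂ V := by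
  refine ⟨fun x => c₁ * φ x, fun y => c₂ * ψ y, ?_, ?_, hφ.memLp.const_mul c₁,
    hψ.memLp.const_mul c₂, ?_⟩
  · filter_upwards [hφ.hasInfluence] with x hx
    have h1 := (hasInfluence_iff_hasDerivWithinAt.1 hx).prodMk
      (hasDerivWithinAt_const (0 : ℝ) (Set.Ioi 0) (S (cdf μ₂)))
    have h2 := HasFDerivAt.comp_hasDerivWithinAt (0 : ℝ) (l := h)
      (by rw [contaminated_zero]; exact hh) h1
    have h3 := (hasInfluence_iff_hasDerivWithinAt (S := fun F => h (S F, S (cdf μ₂)))).2 h2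
    simpa [HasPIF₁, HasInfluence] using h3
  · filter_upwards [hψ.hasInfluence] with y hy
    have h1 := (hasDerivWithinAt_const (0 : ℝ) (Set.Ioi 0) (S (cdf μ₁))).prodMk
      (hasInfluence_iff_hasDerivWithinAt.1 hy)
    have h2 := HasFDerivAt.comp_hasDerivWithinAt (0 : ℝ) (l := h)
      (by rw [contaminated_zero]; exact hh) h1
    have h3 := (hasInfluence_iff_hasDerivWithinAt (S := fun G => h (S (cdf μ₁), S G))).2 h2
    simpa [HasPIF₂, HasInfluence] using h3
  · simp_rw [mul_pow, integral_const_mul]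
    exact hV

section DeltaMethod

variable {Ω : Type*} [MeasurableSpace Ω] {P : Measure Ω} [IsProbabilityMeasure P]
  {μ₁ μ₂ : Measure ℝ} [IsProbabilityMeasure μ₁] [IsProbabilityMeasure μ₂] {X Y : ℕ → Ω → ℝ}
  {S : (ℝ → ℝ) → ℝ} {φ ψ : ℝ → ℝ}

/-- The linearization error of the delta method is negligible against a scale `s` that is at least
of the order of both `n₁^{-1/2}` and `n₂^{-1/2}`. -/
lemma tendsto_measureReal_delta_remainder {A B : ℕ → Ω → ℝ} {a b : ℝ}
    (hA : ∀ κ : ℝ, 0 < κ → ∃ M : ℝ, 0 < M ∧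
      ∀ᶠ n : ℕ in atTop, P.real {ω | M ≤ |√(n : ℝ) * (A n ω - a)|} < κ)
    (hB : ∀ κ : ℝ, 0 < κ → ∃ M : ℝ, 0 < M ∧
      ∀ᶠ n : ℕ in atTop, P.real {ω | M ≤ |√(n : ℝ) * (B n ω - b)|} < κ)
    {h : ℝ × ℝ → ℝ} {L : ℝ × ℝ →L[ℝ] ℝ} (hh : HasFDerivAt h L (a, b)) {s : ℕ × ℕ → ℝ} {c : ℝ}
    (hc : 0 < c) (hs₁ : ∀ᶠ n in atTop ×ˢ atTop, c ≤ √(n.1 : ℝ) * s n)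
    (hs₂ : ∀ᶠ n in atTop ×ˢ atTop, c ≤ √(n.2 : ℝ) * s n) {ε : ℝ} (hε : 0 < ε) :
    Tendsto (fun n : ℕ × ℕ => P.real {ω | ε ≤
      |(h (A n.1 ω, B n.2 ω) - h (a, b) - L (A n.1 ω - a, B n.2 ω - b)) / s n|})
      (atTop ×ˢ atTop) (𝓝 0) := by
  rw [Metric.tendsto_nhds]
  intro κ hκ
  obtain ⟨M₁, hM₁, hA'⟩ := hA (κ / 2) (half_pos hκ)
  obtain ⟨M₂, hM₂, hB'⟩ := hB (κ / 2) (half_pos hκ)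
  -- On the event `√n₁ |A - a| < M₁`, `√n₂ |B - b| < M₂` one has
  -- `c (|A - a| + |B - b|) < s (M₁ + M₂)`.
  set η := ε * c / (M₁ + M₂) with hη
  have hη0 : 0 < η := by positivity
  obtain ⟨δ, hδ0, hδ⟩ := Metric.eventually_nhds_iff.1 (hh.isLittleO.bound hη0)
  have hlarge : ∀ M : ℝ, ∀ᶠ n : ℕ in atTop, M < δ * √(n : ℝ) := fun M =>
    ((Real.tendsto_sqrt_atTop.comp tendsto_natCast_atTop_atTop).const_mul_atTop
      hδ0).eventually_gt_atTop M
  have t1 : Tendsto Prod.fst (atTop ×ˢ atTop : Filter (ℕ × ℕ)) atTop := tendsto_fst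
  have t2 : Tendsto Prod.snd (atTop ×ˢ atTop : Filter (ℕ × ℕ)) atTop := tendsto_snd
  filter_upwards [hs₁, hs₂, t1.eventually hA', t2.eventually hB', t1.eventually (hlarge M₁),
    t2.eventually (hlarge M₂), t1.eventually_gt_atTop 0, t2.eventually_gt_atTop 0]
    with n h1 h2 h3 h4 h5 h6 h7 h8
  have r1 : 0 < √(n.1 : ℝ) := Real.sqrt_pos.2 (Nat.cast_pos.2 h7)
  have r2 : 0 < √(n.2 : ℝ) := Real.sqrt_pos.2 (Nat.cast_pos.2 h8)
  have hsn : 0 < s n := (mul_pos_iff_of_pos_left r1).1 (hc.trans_le h1)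
  rw [Real.dist_eq, sub_zero, abs_of_nonneg measureReal_nonneg]
  refine ((measureReal_mono ?_).trans (measureReal_union_le
    {ω | M₁ ≤ |√(n.1 : ℝ) * (A n.1 ω - a)|}
    {ω | M₂ ≤ |√(n.2 : ℝ) * (B n.2 ω - b)|})).trans_lt (by linarith : _ < κ)
  intro ω hω
  by_contra hcon
  simp only [Set.mem_union, Set.mem_ofPred_eq, not_or, not_le] at hcon hω
  obtain ⟨g1, g2⟩ := hcon
  rw [abs_mul, abs_of_pos r1] at g1
  rw [abs_mul, abs_of_pos r2] at g2
  set u := A n.1 ω - a with hu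
  set v := B n.2 ω - b with hv
  have hd1 : |u| < δ := by
    refine (mul_lt_mul_iff_of_pos_left r1).1 (g1.trans ?_); linarith
  have hd2 : |v| < δ := by
    refine (mul_lt_mul_iff_of_pos_left r2).1 (g2.trans ?_); linarith
  have hbound := @hδ (A n.1 ω, B n.2 ω) (by
    rw [Prod.dist_eq, Real.dist_eq, Real.dist_eq]; exact max_lt hd1 hd2)
  rw [Prod.mk_sub_mk, ← hu, ← hv, Real.norm_eq_abs] at hbound
  have hnorm : ‖(u, v)‖ ≤ |u| + |v| := by
    rw [Prod.norm_def, Real.norm_eq_abs, Real.norm_eq_abs]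
    exact max_le_add_of_nonneg (abs_nonneg _) (abs_nonneg _)
  have k1 : c * |u| < s n * M₁ :=
    calc c * |u| ≤ √(n.1 : ℝ) * s n * |u| := by gcongr
      _ = s n * (√(n.1 : ℝ) * |u|) := by ring
      _ < s n * M₁ := by gcongr
  have k2 : c * |v| < s n * M₂ :=
    calc c * |v| ≤ √(n.2 : ℝ) * s n * |v| := by gcongr
      _ = s n * (√(n.2 : ℝ) * |v|) := by ring
      _ < s n * M₂ := by gcongr
  rw [abs_div, abs_of_pos hsn, le_div_iff₀ hsn] at hω
  have k3 : ε * s n ≤ η * (|u| + |v|) :=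
    hω.trans (hbound.trans (mul_le_mul_of_nonneg_left hnorm hη0.le))
  have k4 : η * (|u| + |v|) < ε * s n := by
    rw [hη, div_mul_eq_mul_div, div_lt_iff₀ (by positivity)]
    have := mul_lt_mul_of_pos_left (add_lt_add k1 k2) hε
    linarith
  linarith

/-- Delta method: a differentiable function of two independent, asymptotically linear plug-in
estimators is asymptotically normal. -/
lemma asymptoticallyNormal_comp
    (hX : ∀ i, HasLaw (X i) μ₁ P) (hY : ∀ i, HasLaw (Y i) μ₂ P)
    (hXind : iIndepFun X P) (hYind : iIndepFun Y P)
    (hXY : IndepFun (fun ω i => X i ω) (fun ω i => Y i ω) P)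
    (hφ : HasInfluenceExpansion P X μ₁ S φ) (hψ : HasInfluenceExpansion P Y μ₂ S ψ)
    {h : ℝ × ℝ → ℝ} (hm : Measurable h) {c₁ c₂ : ℝ} (hc₁ : c₁ ≠ 0) (hc₂ : c₂ ≠ 0)
    (hh : HasFDerivAt h (c₁ • ContinuousLinearMap.fst ℝ ℝ ℝ + c₂ • ContinuousLinearMap.snd ℝ ℝ ℝ)
      (S (cdf μ₁), S (cdf μ₂))) {V : ℕ → ℕ → ℝ}
    (hV : ∀ n₁ n₂ : ℕ, 0 < n₁ → 0 < n₂ → V n₁ n₂ =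
      1 / weight n₁ n₂ * (c₁ ^ 2 * ∫ x, φ x ^ 2 ∂μ₁) +
        1 / weight n₂ n₁ * (c₂ ^ 2 * ∫ y, ψ y ^ 2 ∂μ₂)) :
    AsymptoticallyNormal P X Y (fun F G => h (S F, S G)) (h (S (cdf μ₁), S (cdf μ₂))) V := by
  set a := S (cdf μ₁)
  set b := S (cdf μ₂)
  set A : ℕ → Ω → ℝ := fun n ω => S (empiricalCDF (fun i => X i ω) n) with hAdef
  set B : ℕ → Ω → ℝ := fun n ω => S (empiricalCDF (fun i => Y i ω) n) with hBdef
  set I₁ := ∫ x, φ x ^ 2 ∂μ₁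
  set I₂ := ∫ y, ψ y ^ 2 ∂μ₂
  have hv₁ : 0 < c₁ ^ 2 * I₁ := mul_pos (by positivity) hφ.integral_sq_pos
  have hv₂ : 0 < c₂ ^ 2 * I₂ := mul_pos (by positivity) hψ.integral_sq_pos
  -- `s n` is the asymptotic standard deviation of the estimator.
  set s : ℕ × ℕ → ℝ := fun n => √(c₁ ^ 2 * I₁ / n.1 + c₂ ^ 2 * I₂ / n.2) with hs
  set c := min √(c₁ ^ 2 * I₁) √(c₂ ^ 2 * I₂) with hc
  have hc0 : 0 < c := lt_min (Real.sqrt_pos.2 hv₁) (Real.sqrt_pos.2 hv₂)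
  have t1 : Tendsto Prod.fst (atTop ×ˢ atTop : Filter (ℕ × ℕ)) atTop := tendsto_fst
  have t2 : Tendsto Prod.snd (atTop ×ˢ atTop : Filter (ℕ × ℕ)) atTop := tendsto_snd
  have hpos : ∀ᶠ n : ℕ × ℕ in atTop ×ˢ atTop, 0 < n.1 ∧ 0 < n.2 :=
    (t1.eventually_gt_atTop 0).and (t2.eventually_gt_atTop 0)
  have hs₁ : ∀ᶠ n : ℕ × ℕ in atTop ×ˢ atTop, c ≤ √(n.1 : ℝ) * s n := by
    filter_upwards [hpos] with n hn
    have hn1 : (0 : ℝ) < n.1 := Nat.cast_pos.2 hn.1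
    have hn2 : (0 : ℝ) < n.2 := Nat.cast_pos.2 hn.2
    rw [hs, ← Real.sqrt_mul hn1.le]
    refine (min_le_left _ _).trans (Real.sqrt_le_sqrt ?_)
    rw [mul_add, mul_div_cancel₀ _ hn1.ne']
    linarith [show 0 < (n.1 : ℝ) * (c₂ ^ 2 * I₂ / n.2) by positivity]
  have hs₂ : ∀ᶠ n : ℕ × ℕ in atTop ×ˢ atTop, c ≤ √(n.2 : ℝ) * s n := by
    filter_upwards [hpos] with n hn
    have hn1 : (0 : ℝ) < n.1 := Nat.cast_pos.2 hn.1
    have hn2 : (0 : ℝ) < n.2 := Nat.cast_pos.2 hn.2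
    rw [hs, ← Real.sqrt_mul hn2.le]
    refine (min_le_right _ _).trans (Real.sqrt_le_sqrt ?_)
    rw [mul_add, mul_div_cancel₀ _ hn2.ne']
    linarith [show 0 < (n.2 : ℝ) * (c₁ ^ 2 * I₁ / n.1) by positivity]
  have hclt := tendstoInDistribution_add_normalizedSum hX hY hXind hYind hXY hφ.measurable
    hψ.measurable hφ.integral_eq_zero hψ.integral_eq_zero hφ.integral_sq_pos hψ.integral_sq_pos
    (α := fun n => c₁ / (√(n.1 : ℝ) * s n)) (β := fun n => c₂ / (√(n.2 : ℝ) * s n)) (by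
      filter_upwards [hpos] with n hn
      have hn1 : (0 : ℝ) < n.1 := Nat.cast_pos.2 hn.1
      have hn2 : (0 : ℝ) < n.2 := Nat.cast_pos.2 hn.2
      have hss : s n ^ 2 = c₁ ^ 2 * I₁ / n.1 + c₂ ^ 2 * I₂ / n.2 :=
        Real.sq_sqrt (by positivity)
      have hss0 : 0 < s n ^ 2 := by rw [hss]; positivity
      rw [div_pow, div_pow, mul_pow, mul_pow, Real.sq_sqrt hn1.le, Real.sq_sqrt hn2.le]
      calc c₁ ^ 2 / (n.1 * s n ^ 2) * I₁ + c₂ ^ 2 / (n.2 * s n ^ 2) * I₂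
          = (c₁ ^ 2 * I₁ / n.1 + c₂ ^ 2 * I₂ / n.2) / s n ^ 2 := by field_simp
        _ = 1 := by rw [← hss, div_self hss0.ne'])
  have hmA : ∀ n, AEMeasurable (A n) P := fun n =>
    (hφ.measurable_plugin n).comp_aemeasurable
      (aemeasurable_pi_lambda _ fun i => (hX i).aemeasurable)
  have hmB : ∀ n, AEMeasurable (B n) P := fun n =>
    (hψ.measurable_plugin n).comp_aemeasurable
      (aemeasurable_pi_lambda _ fun i => (hY i).aemeasurable)
  refine tendstoInDistribution_of_tendstoInMeasure_sub _ _ hclt ?_ fun n =>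
    (((hm.comp_aemeasurable ((hmA n.1).prodMk (hmB n.2))).sub_const _).const_mul _).div_const _
  rw [tendstoInMeasure_iff_measureReal_norm]
  intro ε hε
  have hrem := tendsto_measureReal_delta_remainder (P := P) (A := A) (B := B)
    (fun κ hκ => hφ.isAsymptoticallyLinear.tight hX hXind hφ.measurable hφ.memLp
      hφ.integral_eq_zero hκ)
    (fun κ hκ => hψ.isAsymptoticallyLinear.tight hY hYind hψ.measurable hψ.memLp
      hψ.integral_eq_zero hκ) hh hc0 hs₁ hs₂ (show 0 < ε / 3 by positivity)
  have hR₁ := (isAsymptoticallyLinear_iff.1 hφ.isAsymptoticallyLinear (ε / 3 * c / |c₁|)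
    (by positivity)).comp t1
  have hR₂ := (isAsymptoticallyLinear_iff.1 hψ.isAsymptoticallyLinear (ε / 3 * c / |c₂|)
    (by positivity)).comp t2
  have hlim := (hrem.add hR₁).add hR₂
  rw [add_zero, add_zero] at hlim
  refine squeeze_zero' (Eventually.of_forall fun n => measureReal_nonneg) ?_ hlim
  filter_upwards [hpos, hs₁, hs₂] with n hn h1 h2
  refine ((measureReal_mono ?_).trans (measureReal_union_le _ _)).trans
    (add_le_add (measureReal_union_le _ _) le_rfl)
  intro ω hω
  by_contra hcon
  simp only [Set.mem_union, Set.mem_ofPred_eq, not_or, not_le, Pi.sub_apply, Pi.zero_apply,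
    sub_zero, Real.norm_eq_abs] at hcon hω
  obtain ⟨⟨g0, g1⟩, g2⟩ := hcon
  have hn1 : (0 : ℝ) < n.1 := Nat.cast_pos.2 hn.1
  have hn2 : (0 : ℝ) < n.2 := Nat.cast_pos.2 hn.2
  have r1 : 0 < √(n.1 : ℝ) := Real.sqrt_pos.2 hn1
  have r2 : 0 < √(n.2 : ℝ) := Real.sqrt_pos.2 hn2
  have hsn : 0 < s n := (mul_pos_iff_of_pos_left r1).1 (hc0.trans_le h1)
  have hN : 0 < √((n.1 : ℝ) + n.2) := Real.sqrt_pos.2 (by positivity)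
  have hVs : √(V n.1 n.2) = √((n.1 : ℝ) + n.2) * s n := by
    rw [hV _ _ hn.1 hn.2, hs, ← Real.sqrt_mul (by positivity)]
    congr 1
    rw [weight, weight]
    field_simp
    ring
  have hsmall : ∀ {k r x : ℝ}, k ≠ 0 → c ≤ r → |x| < ε / 3 * c / |k| → |k / r * x| < ε / 3 := by
    intro k r x hk hr hx
    have hk0 : 0 < |k| := abs_pos.2 hk
    have hr0 : 0 < r := hc0.trans_le hr
    rw [lt_div_iff₀ hk0] at hx
    rw [abs_mul, abs_div, abs_of_pos hr0, div_mul_eq_mul_div, div_lt_iff₀ hr0]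
    calc |k| * |x| = |x| * |k| := mul_comm _ _
      _ < ε / 3 * c := hx
      _ ≤ ε / 3 * r := by gcongr
  have e1 := hsmall hc₁ h1 g1
  have e2 := hsmall hc₂ h2 g2
  refine absurd hω (not_le.2 ?_)
  calc _ = |(h (A n.1 ω, B n.2 ω) - h (a, b)
          - (c₁ • ContinuousLinearMap.fst ℝ ℝ ℝ + c₂ • ContinuousLinearMap.snd ℝ ℝ ℝ)
            (A n.1 ω - a, B n.2 ω - b)) / s n
        + c₁ / (√(n.1 : ℝ) * s n) * (√(n.1 : ℝ) * (A n.1 ω - a) - normalizedSum φ X n.1 ω)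
        + c₂ / (√(n.2 : ℝ) * s n) * (√(n.2 : ℝ) * (B n.2 ω - b) - normalizedSum ψ Y n.2 ω)| := by
        congr 1
        rw [hVs]
        simp only [add_apply, smul_apply,
          ContinuousLinearMap.coe_fst', ContinuousLinearMap.coe_snd', smul_eq_mul, hAdef, hBdef]
        field_simp
        ring
    _ ≤ _ := (abs_add_le _ _).trans (add_le_add (abs_add_le _ _) le_rfl)
    _ < ε := by linarith

end DeltaMethod

/-! ### Expansions of quantiles and interquantile ranges -/

section Expansions

variable {Ω : Type*} [MeasurableSpace Ω] {P : Measure Ω} [IsProbabilityMeasure P]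
  {μ : Measure ℝ} [IsProbabilityMeasure μ] {f : ℝ → ℝ} {X : ℕ → Ω → ℝ}

lemma RegularAtQuantile.hasDerivAt (hf : Measurable f) (hf0 : ∀ x, 0 ≤ f x)
    (hμ : μ = volume.withDensity fun x => ENNReal.ofReal (f x)) {p : ℝ}
    (hr : RegularAtQuantile (cdf μ) f p) :
    HasDerivAt (cdf μ) (f (quantile (cdf μ) p)) (quantile (cdf μ) p) :=
  hasDerivAt_cdf hf hf0 hμ hr.1

lemma RegularAtQuantile.cdf_quantile (hf : Measurable f) (hf0 : ∀ x, 0 ≤ f x)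
    (hμ : μ = volume.withDensity fun x => ENNReal.ofReal (f x)) {p : ℝ} (hp0 : 0 < p) (hp1 : p < 1)
    (hr : RegularAtQuantile (cdf μ) f p) : cdf μ (quantile (cdf μ) p) = p :=
  QuantileRatio.cdf_quantile hp0 hp1 (hr.hasDerivAt hf hf0 hμ).continuousAt

lemma RegularAtQuantile.quantileDensity_pos {F : ℝ → ℝ} {p : ℝ} (hr : RegularAtQuantile F f p) :
    0 < quantileDensity F f p :=
  one_div_pos.2 hr.2

lemma hasInfluenceExpansion_quantile (hf : Measurable f) (hf0 : ∀ x, 0 ≤ f x)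
    (hμ : μ = volume.withDensity fun x => ENNReal.ofReal (f x))
    (hX : ∀ i, HasLaw (X i) μ P) (hind : iIndepFun X P) {p : ℝ} (hp0 : 0 < p) (hp1 : p < 1)
    (hr : RegularAtQuantile (cdf μ) f p) :
    HasInfluenceExpansion P X μ (fun F => quantile F p)
      (quantileInfluence p (quantile (cdf μ) p) (quantileDensity (cdf μ) f p)) := by
  have hq := hr.cdf_quantile hf hf0 hμ hp0 hp1
  have hd := hr.hasDerivAt hf hf0 hμ
  refine ⟨?_, measurable_quantileInfluence _ _ _, memLp_quantileInfluence hp0 hp1 _ _,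
    integral_quantileInfluence hq _, ?_, measurable_quantile_empiricalCDF hp0 hp1,
    isAsymptoticallyLinear_quantile hX hind hp0 hp1 hr.2 hd hq⟩
  · filter_upwards [ae_ne_of_density hμ (quantile (cdf μ) p)] with x hx
    exact hasInfluence_quantile (monotone_cdf μ) hr.2 hd hq hx
  · rw [integral_quantileInfluence_sq hq]
    exact mul_pos (mul_pos hp0 (by linarith)) (pow_pos hr.quantileDensity_pos 2)

lemma iqr_cdf_pos (hf : Measurable f) (hf0 : ∀ x, 0 ≤ f x)
    (hμ : μ = volume.withDensity fun x => ENNReal.ofReal (f x)) {p : ℝ} (hp0 : 0 < p)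
    (hp1 : p < 1 / 2) (hr : RegularAtQuantile (cdf μ) f p)
    (hr' : RegularAtQuantile (cdf μ) f (1 - p)) : 0 < iqr (cdf μ) p := by
  have hq := hr.cdf_quantile hf hf0 hμ hp0 (by linarith)
  have hq' := hr'.cdf_quantile hf hf0 hμ (by linarith) (by linarith)
  refine sub_pos.2 ((monotone_cdf μ).reflect_lt ?_)
  rw [hq, hq']; linarith

/-- The influence function of the interquantile range. -/
noncomputable def iqrInfluence (F f : ℝ → ℝ) (p x : ℝ) : ℝ :=
  quantileInfluence (1 - p) (quantile F (1 - p)) (quantileDensity F f (1 - p)) x -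
    quantileInfluence p (quantile F p) (quantileDensity F f p) x

lemma integral_iqrInfluence_sq (hf : Measurable f) (hf0 : ∀ x, 0 ≤ f x)
    (hμ : μ = volume.withDensity fun x => ENNReal.ofReal (f x)) {p : ℝ} (hp0 : 0 < p)
    (hp1 : p < 1 / 2) (hr : RegularAtQuantile (cdf μ) f p)
    (hr' : RegularAtQuantile (cdf μ) f (1 - p)) :
    ∫ x, iqrInfluence (cdf μ) f p x ^ 2 ∂μ =
      p * (quantileDensity (cdf μ) f p ^ 2 + quantileDensity (cdf μ) f (1 - p) ^ 2 -
        p * (quantileDensity (cdf μ) f p + quantileDensity (cdf μ) f (1 - p)) ^ 2) :=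
  integral_quantileInfluence_sub_sq hp0 (by linarith)
    (hr.cdf_quantile hf hf0 hμ hp0 (by linarith))
    (hr'.cdf_quantile hf hf0 hμ (by linarith) (by linarith))
    (sub_pos.1 (iqr_cdf_pos hf hf0 hμ hp0 hp1 hr hr')).le _ _

lemma hasInfluenceExpansion_iqr (hf : Measurable f) (hf0 : ∀ x, 0 ≤ f x)
    (hμ : μ = volume.withDensity fun x => ENNReal.ofReal (f x))
    (hX : ∀ i, HasLaw (X i) μ P) (hind : iIndepFun X P) {p : ℝ} (hp0 : 0 < p) (hp1 : p < 1 / 2)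
    (hr : RegularAtQuantile (cdf μ) f p) (hr' : RegularAtQuantile (cdf μ) f (1 - p)) :
    HasInfluenceExpansion P X μ (fun F => iqr F p) (iqrInfluence (cdf μ) f p) := by
  have h := hasInfluenceExpansion_quantile hf hf0 hμ hX hind hp0 (by linarith) hr
  have h' := hasInfluenceExpansion_quantile hf hf0 hμ hX hind (by linarith) (by linarith) hr'
  refine ⟨?_, h'.measurable.sub h.measurable, h'.memLp.sub h.memLp, ?_, ?_,
    fun n => (h'.measurable_plugin n).sub (h.measurable_plugin n),
    h'.isAsymptoticallyLinear.sub h.isAsymptoticallyLinear⟩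
  · filter_upwards [h.hasInfluence, h'.hasInfluence] with x hx hx'
    exact hasInfluence_iff_hasDerivWithinAt.2 ((hasInfluence_iff_hasDerivWithinAt.1 hx').sub
      (hasInfluence_iff_hasDerivWithinAt.1 hx))
  · unfold iqrInfluence
    rw [integral_sub (h'.memLp.integrable one_le_two) (h.memLp.integrable one_le_two),
      h.integral_eq_zero, h'.integral_eq_zero, sub_zero]
  · rw [integral_iqrInfluence_sq hf hf0 hμ hp0 hp1 hr hr']
    set g := quantileDensity (cdf μ) f p
    set g' := quantileDensity (cdf μ) f (1 - p)
    have hg : 0 < g := hr.quantileDensity_pos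
    have hg' : 0 < g' := hr'.quantileDensity_pos
    -- `p (g + g')² < (g + g')² / 2 ≤ g² + g'²`
    have h1 : p * (g + g') ^ 2 < 1 / 2 * (g + g') ^ 2 := by gcongr
    have h2 : 0 ≤ (g - g') ^ 2 := sq_nonneg _
    exact mul_pos hp0 (by linarith)

end Expansions

lemma hasFDerivAt_fst_div_snd {a b : ℝ} (hb : b ≠ 0) :
    HasFDerivAt (fun z : ℝ × ℝ => z.1 / z.2)
      ((1 / b) • ContinuousLinearMap.fst ℝ ℝ ℝ + (-(a / b ^ 2)) • ContinuousLinearMap.snd ℝ ℝ ℝ)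
      (a, b) := by
  have h := (hasFDerivAt_fst (𝕜 := ℝ) (p := (a, b))).mul
    ((hasDerivAt_inv hb).comp_hasFDerivAt (a, b) (hasFDerivAt_snd (𝕜 := ℝ) (p := (a, b))))
  refine h.congr_fderiv ?_
  ext <;> simp [div_eq_mul_inv]

lemma hasFDerivAt_fst_div_snd_sq {a b : ℝ} (hb : b ≠ 0) :
    HasFDerivAt (fun z : ℝ × ℝ => (z.1 / z.2) ^ 2)
      ((2 * a / b ^ 2) • ContinuousLinearMap.fst ℝ ℝ ℝ +
        (-(2 * a ^ 2 / b ^ 3)) • ContinuousLinearMap.snd ℝ ℝ ℝ) (a, b) := by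
  refine ((hasFDerivAt_fst_div_snd hb).pow 2).congr_fderiv ?_
  ext <;> simp <;> field_simp

lemma weight_pos {m n : ℕ} (hm : 0 < m) : 0 < weight m n := by
  have : (0 : ℝ) < m := Nat.cast_pos.2 hm
  unfold weight; positivity

end QuantileRatio

theorem theorem3 {Ω : Type*} [MeasurableSpace Ω] (P : Measure Ω) [IsProbabilityMeasure P]
    (μ₁ μ₂ : Measure ℝ) [IsProbabilityMeasure μ₁] [IsProbabilityMeasure μ₂]
    (f₁ f₂ : ℝ → ℝ) (hf₁ : Measurable f₁) (hf₂ : Measurable f₂)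
    (hf₁_nonneg : ∀ x, 0 ≤ f₁ x) (hf₂_nonneg : ∀ y, 0 ≤ f₂ y)
    (hμ₁ : μ₁ = volume.withDensity (fun x => ENNReal.ofReal (f₁ x)))
    (hμ₂ : μ₂ = volume.withDensity (fun y => ENNReal.ofReal (f₂ y)))
    (X Y : ℕ → Ω → ℝ)
    (hX_law : ∀ i, HasLaw (X i) μ₁ P) (hY_law : ∀ i, HasLaw (Y i) μ₂ P)
    (hX_indep : iIndepFun X P) (hY_indep : iIndepFun Y P)
    (hXY_indep : IndepFun (fun ω i => X i ω) (fun ω i => Y i ω) P) :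
    (∀ p : ℝ, 0 < p → p < 1 →
      RegularAtQuantile (cdf μ₁) f₁ p → RegularAtQuantile (cdf μ₂) f₂ p →
      quantile (cdf μ₁) p ≠ 0 → quantile (cdf μ₂) p ≠ 0 →
      (∀ n₁ n₂ : ℕ, 0 < n₁ → 0 < n₂ →
        IsInfluenceASV (quantileRatio p) μ₁ μ₂ (weight n₁ n₂) (weight n₂ n₁)
          (asvQuantileRatio (cdf μ₁) (cdf μ₂) f₁ f₂ p n₁ n₂)) ∧
      AsymptoticallyNormal P X Y (quantileRatio p) (quantileRatio p (cdf μ₁) (cdf μ₂))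
        (asvQuantileRatio (cdf μ₁) (cdf μ₂) f₁ f₂ p)) ∧
    (∀ p : ℝ, 0 < p → p < 1 / 2 →
      RegularAtQuantile (cdf μ₁) f₁ p → RegularAtQuantile (cdf μ₁) f₁ (1 - p) →
      RegularAtQuantile (cdf μ₂) f₂ p → RegularAtQuantile (cdf μ₂) f₂ (1 - p) →
      (∀ n₁ n₂ : ℕ, 0 < n₁ → 0 < n₂ →
        IsInfluenceASV (sqIqrRatio p) μ₁ μ₂ (weight n₁ n₂) (weight n₂ n₁)
          (asvSqIqrRatio (cdf μ₁) (cdf μ₂) f₁ f₂ p n₁ n₂)) ∧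
      AsymptoticallyNormal P X Y (sqIqrRatio p) (sqIqrRatio p (cdf μ₁) (cdf μ₂))
        (asvSqIqrRatio (cdf μ₁) (cdf μ₂) f₁ f₂ p)) := by
  refine ⟨fun p hp0 hp1 r₁ r₂ hx hy => ?_, fun p hp0 hp1 r₁ r₁' r₂ r₂' => ?_⟩
  · have e₁ := hasInfluenceExpansion_quantile hf₁ hf₁_nonneg hμ₁ hX_law hX_indep hp0 hp1 r₁
    have e₂ := hasInfluenceExpansion_quantile hf₂ hf₂_nonneg hμ₂ hY_law hY_indep hp0 hp1 r₂
    have hd := hasFDerivAt_fst_div_snd (a := quantile (cdf μ₁) p) hy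
    have hm : Measurable fun z : ℝ × ℝ => z.1 / z.2 := measurable_fst.div measurable_snd
    have hV : ∀ n₁ n₂ : ℕ, 0 < n₁ → 0 < n₂ →
        asvQuantileRatio (cdf μ₁) (cdf μ₂) f₁ f₂ p n₁ n₂ =
          1 / weight n₁ n₂ * ((1 / quantile (cdf μ₂) p) ^ 2 *
            ∫ x, quantileInfluence p (quantile (cdf μ₁) p)
              (quantileDensity (cdf μ₁) f₁ p) x ^ 2 ∂μ₁) +
          1 / weight n₂ n₁ * ((-(quantile (cdf μ₁) p / quantile (cdf μ₂) p ^ 2)) ^ 2 *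
            ∫ y, quantileInfluence p (quantile (cdf μ₂) p)
              (quantileDensity (cdf μ₂) f₂ p) y ^ 2 ∂μ₂) := fun n₁ n₂ h₁ h₂ => by
      have w₁ := (weight_pos (n := n₂) h₁).ne'
      have w₂ := (weight_pos (n := n₁) h₂).ne'
      rw [asvQuantileRatio, quantileRatio,
        integral_quantileInfluence_sq (r₁.cdf_quantile hf₁ hf₁_nonneg hμ₁ hp0 hp1),
        integral_quantileInfluence_sq (r₂.cdf_quantile hf₂ hf₂_nonneg hμ₂ hp0 hp1)]
      field_simp
    exact ⟨fun n₁ n₂ h₁ h₂ => isInfluenceASV_comp e₁ e₂ hd (hV n₁ n₂ h₁ h₂),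
      asymptoticallyNormal_comp hX_law hY_law hX_indep hY_indep hXY_indep e₁ e₂ hm
        (one_div_ne_zero hy) (neg_ne_zero.2 (div_ne_zero hx (pow_ne_zero 2 hy))) hd hV⟩
  · have e₁ := hasInfluenceExpansion_iqr hf₁ hf₁_nonneg hμ₁ hX_law hX_indep hp0 hp1 r₁ r₁'
    have e₂ := hasInfluenceExpansion_iqr hf₂ hf₂_nonneg hμ₂ hY_law hY_indep hp0 hp1 r₂ r₂'
    have hx := (iqr_cdf_pos hf₁ hf₁_nonneg hμ₁ hp0 hp1 r₁ r₁').ne'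
    have hy := (iqr_cdf_pos hf₂ hf₂_nonneg hμ₂ hp0 hp1 r₂ r₂').ne'
    have hd := hasFDerivAt_fst_div_snd_sq (a := iqr (cdf μ₁) p) hy
    have hm : Measurable fun z : ℝ × ℝ => (z.1 / z.2) ^ 2 :=
      (measurable_fst.div measurable_snd).pow_const 2
    have hV : ∀ n₁ n₂ : ℕ, 0 < n₁ → 0 < n₂ →
        asvSqIqrRatio (cdf μ₁) (cdf μ₂) f₁ f₂ p n₁ n₂ =
          1 / weight n₁ n₂ * ((2 * iqr (cdf μ₁) p / iqr (cdf μ₂) p ^ 2) ^ 2 *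
            ∫ x, iqrInfluence (cdf μ₁) f₁ p x ^ 2 ∂μ₁) +
          1 / weight n₂ n₁ * ((-(2 * iqr (cdf μ₁) p ^ 2 / iqr (cdf μ₂) p ^ 3)) ^ 2 *
            ∫ y, iqrInfluence (cdf μ₂) f₂ p y ^ 2 ∂μ₂) := fun n₁ n₂ h₁ h₂ => by
      have w₁ := (weight_pos (n := n₂) h₁).ne'
      have w₂ := (weight_pos (n := n₁) h₂).ne'
      rw [asvSqIqrRatio, sqIqrRatio, integral_iqrInfluence_sq hf₁ hf₁_nonneg hμ₁ hp0 hp1 r₁ r₁',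
        integral_iqrInfluence_sq hf₂ hf₂_nonneg hμ₂ hp0 hp1 r₂ r₂']
      field_simp
      ring
    exact ⟨fun n₁ n₂ h₁ h₂ => isInfluenceASV_comp e₁ e₂ hd (hV n₁ n₂ h₁ h₂),
      asymptoticallyNormal_comp hX_law hY_law hX_indep hY_indep hXY_indep e₁ e₂ hm
        (div_ne_zero (mul_ne_zero two_ne_zero hx) (pow_ne_zero 2 hy))
        (neg_ne_zero.2 (div_ne_zero (mul_ne_zero two_ne_zero (pow_ne_zero 2 hx))
          (pow_ne_zero 3 hy))) hd hV⟩
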